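/- Let $\lambda,\mu,c,\varepsilon>0$. Let $(\tau_k)_{k\ge1}$ be i.i.d. interclaim times and $(X_k)_{k\ge1}$ i.i.d. claim sizes, the two sequences being independent, let $N(t)=\#\{n\ge1:\tau_1+\dots+\tau_n\le t\}$, and for a premium rate function $p$ and $u\ge0$ let $$U(t)=u+\int_0^t p(U(s))\,ds-\sum_{k=1}^{N(t)}X_k,\qquad T_u=\inf\{t\ge0: U(t)<0\},\qquad \psi(u)=\mathbb P(T_u<\infty).$$ Write $\psi_{l,i}$ for $\psi$ with the linear premium $p(x)=c+\varepsilon x$ and $\psi_{c,i}$ for $\psi$ with the constant premium $p(x)=c$, where - $i=2$: $\tau_k$ is Erlang$(2,\lambda)$ (density $\lambda^2te^{-\lambda t}$) and $X_k$ is Exp$(\mu)$ (density $\mu e^{-\mu x}$); - $i=3$: $\tau_k$ is Exp$(\lambda)$ and $X_k$ is Erlang$(2,\mu)$. Then $$\lim_{u\to\infty}\frac{\psi_{l,2}(u)}{\psi_{c,2}(u)}=0\qquad\text{and}\qquad\lim_{u\to\infty}\frac{\psi_{l,3}(u)}{\psi_{c,3}(u)}=0 .$$ Moreover, if $\frac{2c}{\lambda}>\frac1\mu$,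 then there is a constant $C>0$, depending only on $\lambda,\mu,c,\varepsilon$, such that $$\frac{\psi_{l,2}(u)}{\psi_{c,2}(u)}\sim C\,\exp\Big(-\frac{c\mu+2\lambda-\sqrt{c^2\mu^2+4c\lambda\mu}}{2c}\,u\Big)(c+\varepsilon u)^{-2},\qquad u\to\infty .$$ -/

import Mathlib

open MeasureTheory ProbabilityTheory Filter Topology Asymptotics

/-- The time of the `n`-th claim, `T_n = τ_1 + ⋯ + τ_n`, where `τ_k` (`k ≥ 1`) is the entry `k - 1`
of the sequence `τ`. -/
def claimTime (τ : ℕ → ℝ) (n : ℕ) : ℝ := ∑ k ∈ Finset.range n, τ k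

/-- The number of claims up to time `t`, `N(t) = #{n ≥ 1 : T_n ≤ t}`. -/
noncomputable def claimCount (τ : ℕ → ℝ) (t : ℝ) : ℕ :=
  Set.ncard {n : ℕ | 1 ≤ n ∧ claimTime τ n ≤ t}

/-- `x` is a surplus path with initial value `u`, premium rate function `p`, interclaim times `τ`
and claim sizes `X`: for all `t ≥ 0`,
`x(t) = u + ∫_0^t p(x(s)) ds - ∑_{k=1}^{N(t)} X_k`. -/
def IsSurplusPath (p : ℝ → ℝ) (τ X : ℕ → ℝ) (u : ℝ) (x : ℝ → ℝ) : Prop :=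
  ∀ t : ℝ, 0 ≤ t →
    IntervalIntegrable (fun s => p (x s)) volume 0 t ∧
      x t = u + (∫ s in (0 : ℝ)..t, p (x s)) - ∑ k ∈ Finset.range (claimCount τ t), X k

/-- The time of ruin `inf {t ≥ 0 : x(t) < 0}` of a path, with `inf ∅ = ∞`. -/
noncomputable def ruinTime (x : ℝ → ℝ) : EReal :=
  sInf ((fun t : ℝ => (t : EReal)) '' {t : ℝ | 0 ≤ t ∧ x t < 0})

/-- A renewal risk model with premium rate `p(U(t))` at time `t`, on a probability space `(Ω, P)`:
i.i.d. interclaim times `τ` with law `νT` and i.i.d. claim sizes `X` with law `νX`, the two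
sequences being independent of one another, and for every initial value `u ≥ 0` the surplus process
`U u t` driven by them. -/
structure RiskModel (νT νX : Measure ℝ) (p : ℝ → ℝ) where
  Ω : Type*
  [mΩ : MeasurableSpace Ω]
  P : Measure Ω
  [isProb : IsProbabilityMeasure P]
  τ : ℕ → Ω → ℝ
  X : ℕ → Ω → ℝ
  U : ℝ → ℝ → Ω → ℝ
  measurable_τ : ∀ k, Measurable (τ k)
  measurable_X : ∀ k, Measurable (X k)
  law_τ : ∀ k, P.map (τ k) = νT
  law_X : ∀ k, P.map (X k) = νX
  indep : iIndepFun (Sum.elim τ X) P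
  surplus : ∀ u : ℝ, 0 ≤ u →
    ∀ᵐ ω ∂P, IsSurplusPath p (fun k => τ k ω) (fun k => X k ω) u (fun t => U u t ω)

attribute [instance] RiskModel.mΩ RiskModel.isProb

/-- The ruin probability `ψ(u) = P(T_u < ∞)` for the initial value `u ≥ 0`. -/
noncomputable def RiskModel.ruinProb {νT νX : Measure ℝ} {p : ℝ → ℝ} (M : RiskModel νT νX p)
    (u : ℝ) : ℝ :=
  M.P.real {ω | ruinTime (fun t => M.U u t ω) < ⊤}

/-- The Erlang(2, `r`) distribution, with density `r² x e^{-r x}` on `x ≥ 0`. -/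
noncomputable def erlangTwo (r : ℝ) : Measure ℝ := gammaMeasure 2 r

/-- The linear premium rate function `p(x) = c + ε x`. -/
def linearPremium (c ε : ℝ) : ℝ → ℝ := fun x => c + ε * x

/-- The constant premium rate function `p(x) = c`. -/
def constPremium (c : ℝ) : ℝ → ℝ := fun _ => c

/-!
Observed at claim times, the surplus is a Markov chain: it follows the flow of `y' = c + ε y`
(`ε = 0` for the constant premium) and drops by a claim. Ruin can only occur at a claim, so the ruin
probability is the increasing limit of the iterates of the transition operator `T` of the chain,
stopped when negative, applied to the indicator of the negative half-line
(`RiskModel.ofReal_ruinProb`). Hence it is a fixed point of `T`, it lies below every supersolution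
(`ruinValue_le_of_ruinOp_le`), and it lies above every subsolution whose part on the survival states
is contracted by `T` (`le_ruinValue_of_le_ruinOp`).

For a constant premium, the function `1` on `y < 0`, `K e^{-R y}` on `y ≥ 0`, with `R` the
adjustment coefficient, is such a solution. For exponential claims it is exact
(`ruinValue_const_expMeasure`), for Erlang claims it is a lower bound, and in both cases `R` is
strictly below the rate `μ` of the claims. The net profit condition is not needed for an exponential
lower bound, as raising the premium only makes ruin less likely.

For a linear premium, the premium rate exceeds every bound far out, so the exponent of the decay is
arbitrarily close to `μ` (`exists_ruinValue_linear_le`), which settles both limits. For exponential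
claims, memorylessness turns the renewal equation into
`ψ(u) = E[e^{-μ φ} h(φ)]`, where `φ` is the surplus just before the first claim and
`h(y) = ∫_{w ≤ y} μ e^{μ w} ψ(w) dw`. An explicit supersolution shows that `h` is bounded
(`lintegral_exp_mul_ruinValue_ne_top`); since `φ ≥ u` and `h` increases to a limit `H`, it follows
that `ψ(u) ~ H · E[e^{-μ φ}]`. Only interclaim times of order `1 / (c + ε u)` matter in the last
expectation, and as the Erlang(2, `λ`) density is `λ² t` to first order near `0`, it is asymptotic
to `(λ / μ)² e^{-μ u} (c + ε u)^{-2}` (`tendsto_lintegral_exp_premiumFlow`).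
-/

open scoped ENNReal

/-! ### The surplus at claim times and its ruin operator -/

/-- The solution at time `t` of `y' = c + ε y` with initial value `y`. Writing `(e^{εt} - 1) / ε` as
an integral makes the formula valid for `ε = 0` too, which is the case of a constant premium. -/
noncomputable def premiumFlow (c ε y t : ℝ) : ℝ :=
  y + (c + ε * y) * ∫ s in (0 : ℝ)..t, Real.exp (ε * s)

/-- One step of the surplus observed at claim times: from `y`, an interclaim time `t` followed by a
claim `x`. Negative values are absorbing, so that ruin by the `n`-th claim is a property of the
`n`-th value alone. -/
noncomputable def stoppedStep (c ε y : ℝ) (z : ℝ × ℝ) : ℝ :=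
  if y < 0 then y else premiumFlow c ε y z.1 - z.2

/-- The transition operator of the Markov chain with steps `stoppedStep`. -/
noncomputable def ruinOp (c ε : ℝ) (νT νX : Measure ℝ) (f : ℝ → ℝ≥0∞) (y : ℝ) : ℝ≥0∞ :=
  ∫⁻ z, f (stoppedStep c ε y z) ∂(νT.prod νX)

/-- The probability of ruin by the `n`-th claim, as a function of the initial value. -/
noncomputable def ruinIter (c ε : ℝ) (νT νX : Measure ℝ) (n : ℕ) : ℝ → ℝ≥0∞ :=
  (ruinOp c ε νT νX)^[n] ((Set.Iio 0).indicator 1)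

/-- The probability of ultimate ruin, as a function of the initial value. -/
noncomputable def ruinValue (c ε : ℝ) (νT νX : Measure ℝ) (y : ℝ) : ℝ≥0∞ :=
  ⨆ n, ruinIter c ε νT νX n y

lemma continuous_premiumFlow (c ε : ℝ) :
    Continuous fun q : ℝ × ℝ => premiumFlow c ε q.1 q.2 := by
  have h : Continuous fun t : ℝ => ∫ s in (0 : ℝ)..t, Real.exp (ε * s) :=
    intervalIntegral.continuous_primitive (fun a b => (by fun_prop : Continuous fun s : ℝ =>
      Real.exp (ε * s)).intervalIntegrable a b) 0
  unfold premiumFlow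
  have h2 := h.comp (continuous_snd (X := ℝ) (Y := ℝ))
  simp only [Function.comp_def] at h2
  fun_prop

lemma measurable_stoppedStep (c ε : ℝ) :
    Measurable fun q : ℝ × (ℝ × ℝ) => stoppedStep c ε q.1 q.2 := by
  unfold stoppedStep
  refine Measurable.ite (measurableSet_lt measurable_fst measurable_const) measurable_fst ?_
  exact ((continuous_premiumFlow c ε).measurable.comp
    (measurable_fst.prodMk measurable_snd.fst)).sub measurable_snd.snd

lemma le_integral_exp {ε t : ℝ} (hε : 0 ≤ ε) (ht : 0 ≤ t) :
    t ≤ ∫ s in (0 : ℝ)..t, Real.exp (ε * s) := by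
  have h : ∫ s in (0 : ℝ)..t, (1 : ℝ) ≤ ∫ s in (0 : ℝ)..t, Real.exp (ε * s) := by
    refine intervalIntegral.integral_mono_on ht (by simp)
      ((by fun_prop : Continuous fun s : ℝ => Real.exp (ε * s)).intervalIntegrable _ _) ?_
    intro s hs
    exact Real.one_le_exp (mul_nonneg hε hs.1)
  simpa using h

lemma le_premiumFlow {c ε y t : ℝ} (hc : 0 ≤ c) (hε : 0 ≤ ε) (hy : 0 ≤ y) (ht : 0 ≤ t) :
    y + (c + ε * y) * t ≤ premiumFlow c ε y t := by
  unfold premiumFlow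
  have := mul_le_mul_of_nonneg_left (le_integral_exp hε ht)
    (add_nonneg hc (mul_nonneg hε hy))
  linarith

lemma premiumFlow_mono {c c' ε y y' t : ℝ} (hcc : c ≤ c') (hε : 0 ≤ ε) (hyy : y ≤ y')
    (ht : 0 ≤ t) : premiumFlow c ε y t ≤ premiumFlow c' ε y' t := by
  unfold premiumFlow
  have h0 : 0 ≤ ∫ s in (0 : ℝ)..t, Real.exp (ε * s) := ht.trans (le_integral_exp hε ht)
  have : c + ε * y ≤ c' + ε * y' := add_le_add hcc (mul_le_mul_of_nonneg_left hyy hε)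
  have := mul_le_mul_of_nonneg_right this h0
  linarith

section RuinOp

variable {c ε : ℝ} {νT νX : Measure ℝ}

lemma ruinOp_mono {f g : ℝ → ℝ≥0∞} (h : f ≤ g) : ruinOp c ε νT νX f ≤ ruinOp c ε νT νX g :=
  fun _ => lintegral_mono fun _ => h _

lemma measurable_ruinIter [SFinite νT] [SFinite νX] (n : ℕ) :
    Measurable (ruinIter c ε νT νX n) := by
  induction n with
  | zero => exact measurable_one.indicator measurableSet_Iio
  | succ n ih =>
    rw [ruinIter, Function.iterate_succ_apply']
    exact Measurable.lintegral_prod_right' (ν := νT.prod νX)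
      (f := fun q : ℝ × (ℝ × ℝ) => ruinIter c ε νT νX n (stoppedStep c ε q.1 q.2))
      (ih.comp (measurable_stoppedStep c ε))

lemma ruinIter_succ (n : ℕ) :
    ruinIter c ε νT νX (n + 1) = ruinOp c ε νT νX (ruinIter c ε νT νX n) := by
  rw [ruinIter, Function.iterate_succ_apply']; rfl

lemma measurable_ruinValue [SFinite νT] [SFinite νX] : Measurable (ruinValue c ε νT νX) :=
  Measurable.iSup fun n => measurable_ruinIter n

lemma ruinOp_of_neg [IsProbabilityMeasure νT] [IsProbabilityMeasure νX] (f : ℝ → ℝ≥0∞) {y : ℝ}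
    (hy : y < 0) : ruinOp c ε νT νX f y = f y := by
  simp [ruinOp, stoppedStep, hy]

lemma ruinOp_of_nonneg [SFinite νX] {f : ℝ → ℝ≥0∞} (hf : Measurable f) {y : ℝ} (hy : 0 ≤ y) :
    ruinOp c ε νT νX f y = ∫⁻ t, ∫⁻ x, f (premiumFlow c ε y t - x) ∂νX ∂νT := by
  rw [ruinOp, lintegral_prod]
  · simp [stoppedStep, not_lt.2 hy]
  · exact (hf.comp ((measurable_stoppedStep c ε).comp
      (measurable_const.prodMk measurable_id))).aemeasurable

lemma monotone_ruinIter [IsProbabilityMeasure νT] [IsProbabilityMeasure νX] :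
    Monotone (ruinIter c ε νT νX) := by
  refine monotone_nat_of_le_succ fun n => ?_
  induction n with
  | zero =>
    intro y
    rcases lt_or_ge y 0 with hy | hy
    · rw [ruinIter_succ, ruinOp_of_neg _ hy]
    · simp [ruinIter, hy]
  | succ n ih =>
    calc ruinIter c ε νT νX (n + 1) = ruinOp c ε νT νX (ruinIter c ε νT νX n) := ruinIter_succ n
      _ ≤ ruinOp c ε νT νX (ruinIter c ε νT νX (n + 1)) := ruinOp_mono ih
      _ = ruinIter c ε νT νX (n + 1 + 1) := (ruinIter_succ (n + 1)).symm

lemma ruinValue_of_neg [IsProbabilityMeasure νT] [IsProbabilityMeasure νX] {y : ℝ} (hy : y < 0) :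
    ruinValue c ε νT νX y = 1 := by
  have (n : ℕ) : ruinIter c ε νT νX n y = 1 := by
    induction n with
    | zero => simp [ruinIter, hy]
    | succ n ih => rw [ruinIter_succ, ruinOp_of_neg _ hy, ih]
  simp [ruinValue, this]

lemma ruinOp_ruinValue [IsProbabilityMeasure νT] [IsProbabilityMeasure νX] (y : ℝ) :
    ruinOp c ε νT νX (ruinValue c ε νT νX) y = ruinValue c ε νT νX y := by
  have h : ruinOp c ε νT νX (ruinValue c ε νT νX) y = ⨆ n, ruinIter c ε νT νX (n + 1) y := by
    simp only [ruinIter_succ]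
    unfold ruinOp ruinValue
    rw [lintegral_iSup]
    · exact fun n => (measurable_ruinIter n).comp ((measurable_stoppedStep c ε).comp
        (measurable_const.prodMk measurable_id))
    · exact fun m n hmn z => monotone_ruinIter hmn _
  rw [h]
  exact Monotone.iSup_nat_add (f := fun n => ruinIter c ε νT νX n y)
    (fun m n hmn => monotone_ruinIter hmn y) 1

/-- A supersolution of the renewal equation bounds the ruin probability from above. -/
lemma ruinValue_le_of_ruinOp_le {V : ℝ → ℝ≥0∞} (h0 : (Set.Iio 0).indicator 1 ≤ V)
    (hV : ruinOp c ε νT νX V ≤ V) : ruinValue c ε νT νX ≤ V := by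
  refine fun y => iSup_le fun n => ?_
  have : ruinIter c ε νT νX n ≤ V := by
    induction n with
    | zero => exact h0
    | succ n ih => rw [ruinIter_succ]; exact (ruinOp_mono ih).trans hV
  exact this y

/-- A subsolution `f` of the renewal equation bounds the ruin probability from below, provided that
its part `g` on the survival states is contracted by the operator: that part is the
contribution of the paths that have not been ruined by the `n`-th claim, and it vanishes as
`n → ∞`. -/
lemma le_ruinValue_of_le_ruinOp [SFinite νT] [SFinite νX] {f g : ℝ → ℝ≥0∞} {ρ : ℝ≥0∞}
    (hfg : f ≤ (Set.Iio 0).indicator 1 + g) (hf : f ≤ ruinOp c ε νT νX f)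
    (hρ : ρ < 1) (hg : ruinOp c ε νT νX g ≤ ρ • g) {y : ℝ} (hy : g y ≠ ∞) :
    f y ≤ ruinValue c ε νT νX y := by
  have key (n : ℕ) : f ≤ ruinIter c ε νT νX n + ρ ^ n • g := by
    induction n with
    | zero => simpa [ruinIter] using hfg
    | succ n ih =>
      refine hf.trans ((ruinOp_mono ih).trans fun y => ?_)
      have hm : Measurable fun z => ruinIter c ε νT νX n (stoppedStep c ε y z) :=
        (measurable_ruinIter n).comp ((measurable_stoppedStep c ε).comp
          (measurable_const.prodMk measurable_id))
      have e : ruinOp c ε νT νX (ruinIter c ε νT νX n + ρ ^ n • g) y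
          = ruinOp c ε νT νX (ruinIter c ε νT νX n) y + ρ ^ n * ruinOp c ε νT νX g y := by
        simp only [ruinOp, Pi.add_apply, Pi.smul_apply, smul_eq_mul]
        rw [lintegral_add_left hm, lintegral_const_mul' _ _
          (ENNReal.pow_ne_top (hρ.trans ENNReal.one_lt_top).ne)]
      rw [e, ruinIter_succ]
      simp only [Pi.add_apply, Pi.smul_apply, smul_eq_mul]
      rw [pow_succ, mul_assoc]
      gcongr
      exact hg y
  have hlim : Tendsto (fun n : ℕ => ruinValue c ε νT νX y + ρ ^ n * g y) atTop
      (𝓝 (ruinValue c ε νT νX y + 0 * g y)) :=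
    tendsto_const_nhds.add (ENNReal.Tendsto.mul_const
      (ENNReal.tendsto_pow_atTop_nhds_zero_of_lt_one hρ) (Or.inr hy))
  rw [zero_mul, add_zero] at hlim
  refine ge_of_tendsto' hlim fun n => (key n y).trans ?_
  simp only [Pi.add_apply, Pi.smul_apply, smul_eq_mul]
  gcongr
  exact le_iSup (fun n => ruinIter c ε νT νX n y) n

lemma ruinValue_le_one [IsProbabilityMeasure νT] [IsProbabilityMeasure νX] (y : ℝ) :
    ruinValue c ε νT νX y ≤ 1 := by
  refine ruinValue_le_of_ruinOp_le (V := 1) ?_ ?_ y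
  · exact Set.indicator_le fun _ _ => le_rfl
  · intro y; simp [ruinOp]

/-- A larger premium makes ruin less likely. -/
lemma ruinValue_anti_premium [IsProbabilityMeasure νT] [IsProbabilityMeasure νX] {c' : ℝ}
    (hT : ∀ᵐ t ∂νT, 0 ≤ t) (hcc : c ≤ c') (hε : 0 ≤ ε) (y : ℝ) :
    ruinValue c' ε νT νX y ≤ ruinValue c ε νT νX y := by
  have key (n : ℕ) : ∀ y y' : ℝ, y ≤ y' →
      ruinIter c' ε νT νX n y' ≤ ruinIter c ε νT νX n y := by
    induction n with
    | zero =>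
      intro y y' h
      simp only [ruinIter, Function.iterate_zero, id_eq]
      rcases lt_or_ge y 0 with hy | hy
      · rw [Set.indicator_of_mem (s := Set.Iio 0) (a := y) hy]
        exact Set.indicator_le (fun _ _ => le_rfl) y'
      · simp [hy.trans h]
    | succ n ih =>
      intro y y' h
      rcases lt_or_ge y 0 with hy | hy
      · have h1 : ruinIter c ε νT νX (n + 1) y = 1 := by
          refine le_antisymm ((le_iSup (fun n => ruinIter c ε νT νX n y) (n + 1)).trans
            (ruinValue_le_one y)) ?_
          have := monotone_ruinIter (c := c) (ε := ε) (νT := νT) (νX := νX)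
            (Nat.zero_le (n + 1)) y
          simpa [ruinIter, hy] using this
        rw [h1]
        exact (le_iSup (fun n => ruinIter c' ε νT νX n y') (n + 1)).trans (ruinValue_le_one y')
      · rw [ruinIter_succ, ruinIter_succ, ruinOp_of_nonneg (measurable_ruinIter n) hy,
          ruinOp_of_nonneg (measurable_ruinIter n) (hy.trans h)]
        refine lintegral_mono_ae ?_
        filter_upwards [hT] with t ht
        refine lintegral_mono fun x => ih _ _ ?_
        have := premiumFlow_mono hcc hε h ht
        linarith
  exact iSup_mono fun n => key n y y le_rfl

end RuinOp

/-! ### Surplus paths and the chain of surpluses at claim times -/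

/-- The chain of surpluses at the claim times, stopped at the first negative value. -/
noncomputable def stoppedChain (c ε : ℝ) (τ X : ℕ → ℝ) (u : ℝ) : ℕ → ℝ
  | 0 => u
  | n + 1 => stoppedStep c ε (stoppedChain c ε τ X u n) (τ n, X n)

lemma one_add_mul_integral_exp (ε t : ℝ) :
    1 + ε * ∫ s in (0 : ℝ)..t, Real.exp (ε * s) = Real.exp (ε * t) := by
  have h : ∫ s in (0 : ℝ)..t, ε * Real.exp (ε * s) = Real.exp (ε * t) - Real.exp (ε * 0) := by
    refine intervalIntegral.integral_eq_sub_of_hasDerivAt (f := fun s => Real.exp (ε * s)) ?_ ?_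
    · intro s _
      have := ((hasDerivAt_id s).const_mul ε).exp
      simpa [mul_comm] using this
    · exact (by fun_prop : Continuous fun s : ℝ => ε * Real.exp (ε * s)).intervalIntegrable _ _
  rw [intervalIntegral.integral_const_mul] at h
  rw [h]; simp

lemma hasDerivAt_integral_exp (ε t : ℝ) :
    HasDerivAt (fun t : ℝ => ∫ s in (0 : ℝ)..t, Real.exp (ε * s)) (Real.exp (ε * t)) t :=
  (by fun_prop : Continuous fun s : ℝ => Real.exp (ε * s)).integral_hasStrictDerivAt 0 t
    |>.hasDerivAt

/-- Uniqueness for the integral equation of the surplus between two claims. The integrand `G` has to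
agree with `F` before the final time only, as the surplus jumps there. -/
lemma eq_premiumFlow_of_integral_eq {c ε a b : ℝ} {F G : ℝ → ℝ} (hab : a ≤ b)
    (hint : IntervalIntegrable (fun s => c + ε * G s) volume a b)
    (hF : ∀ t ∈ Set.Icc a b, F t = F a + ∫ s in a..t, (c + ε * G s))
    (hG : ∀ t ∈ Set.Ico a b, G t = F t) {t : ℝ} (ht : t ∈ Set.Icc a b) :
    F t = premiumFlow c ε (F a) (t - a) := by
  have hcont : ContinuousOn F (Set.Icc a b) := by
    have h1 := intervalIntegral.continuousOn_primitive_interval' hint Set.left_mem_uIcc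
    rw [Set.uIcc_of_le hab] at h1
    exact (continuousOn_const.add h1).congr hF
  -- extending `F` continuously to the line makes the right-hand side differentiable everywhere
  set F' : ℝ → ℝ := Set.IccExtend hab (Set.domRestrict (Set.Icc a b) F) with hF'
  have hF'c : Continuous F' := (continuousOn_iff_continuous_domRestrict.1 hcont).Icc_extend'
  have hF'e : ∀ s ∈ Set.Icc a b, F' s = F s := fun s hs => by
    rw [hF', Set.IccExtend_of_mem hab _ hs]; rfl
  set H : ℝ → ℝ := fun t => F a + ∫ s in a..t, (c + ε * F' s) with hH
  have hHF : ∀ s ∈ Set.Icc a b, H s = F s := by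
    intro s hs
    have hI : ∫ r in a..s, (c + ε * F' r) = ∫ r in a..s, (c + ε * G r) := by
      refine intervalIntegral.integral_congr_ae ?_
      have hne : ∀ᵐ r ∂(volume : Measure ℝ), r ≠ s := by simp [ae_iff]
      filter_upwards [hne] with r hr hrI
      rw [Set.uIoc_of_le hs.1] at hrI
      have hr' : r < s := lt_of_le_of_ne hrI.2 hr
      rw [hF'e r ⟨hrI.1.le, hr'.le.trans hs.2⟩, hG r ⟨hrI.1.le, hr'.trans_le hs.2⟩]
    rw [hF s hs, ← hI]
  have hHd : ∀ s, HasDerivAt H (c + ε * F' s) s := fun s =>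
    ((by fun_prop : Continuous fun s : ℝ => c + ε * F' s).integral_hasStrictDerivAt a s
      |>.hasDerivAt).const_add _
  have hW : ∀ s ∈ Set.Icc a b,
      (H s - premiumFlow c ε (F a) (s - a)) * Real.exp (-(ε * s))
        = (H a - premiumFlow c ε (F a) (a - a)) * Real.exp (-(ε * a)) := by
    have hd : ∀ s ∈ Set.Icc a b, HasDerivAt
        (fun s => (H s - premiumFlow c ε (F a) (s - a)) * Real.exp (-(ε * s))) 0 s := by
      intro s hs
      have h1 : HasDerivAt (fun s => premiumFlow c ε (F a) (s - a))
          ((c + ε * F a) * Real.exp (ε * (s - a))) s := by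
        have := (hasDerivAt_integral_exp ε (s - a)).comp s ((hasDerivAt_id s).sub_const a)
        simpa [premiumFlow, Function.comp_def] using (this.const_mul (c + ε * F a)).const_add (F a)
      have h2 : HasDerivAt (fun s => Real.exp (-(ε * s))) (Real.exp (-(ε * s)) * -ε) s := by
        have := ((hasDerivAt_id s).const_mul ε).neg.exp
        simpa using this
      refine (((hHd s).sub h1).mul h2).congr_deriv ?_
      rw [hF'e s hs, ← hHF s hs, ← one_add_mul_integral_exp]
      simp only [Pi.sub_apply, premiumFlow]
      ring
    intro s hs
    exact constant_of_has_deriv_right_zero (fun r hr => (hd r hr).continuousAt.continuousWithinAt)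
      (fun r hr => (hd r ⟨hr.1, hr.2.le⟩).hasDerivWithinAt) s hs
  have h0 : H a - premiumFlow c ε (F a) (a - a) = 0 := by simp [hH, premiumFlow]
  have := hW t ht
  rw [h0, zero_mul, mul_eq_zero, or_iff_left (Real.exp_ne_zero _), hHF t ht] at this
  linarith

lemma ruinTime_lt_top_iff (x : ℝ → ℝ) : ruinTime x < ⊤ ↔ ∃ t, 0 ≤ t ∧ x t < 0 := by
  rw [ruinTime, sInf_lt_iff]
  constructor
  · rintro ⟨_, ⟨t, ht, rfl⟩, -⟩
    exact ⟨t, ht⟩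
  · rintro ⟨t, ht⟩
    exact ⟨t, ⟨t, ht, rfl⟩, EReal.coe_lt_top t⟩

lemma strictMono_claimTime {τ : ℕ → ℝ} (hτ : ∀ k, 0 < τ k) : StrictMono (claimTime τ) :=
  strictMono_nat_of_lt_succ fun n => by
    rw [claimTime, claimTime, Finset.sum_range_succ]; linarith [hτ n]

lemma claimCount_eq {τ : ℕ → ℝ} (hτ : ∀ k, 0 < τ k) {n : ℕ} {t : ℝ}
    (ht : t ∈ Set.Ico (claimTime τ n) (claimTime τ (n + 1))) : claimCount τ t = n := by
  have : {m : ℕ | 1 ≤ m ∧ claimTime τ m ≤ t} = (Finset.Icc 1 n : Finset ℕ) := by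
    ext m
    simp only [Set.mem_ofPred_eq, Finset.coe_Icc, Set.mem_Icc, and_congr_right_iff]
    intro _
    constructor
    · intro h
      exact Nat.lt_succ_iff.1 ((strictMono_claimTime hτ).lt_iff_lt.1 (h.trans_lt ht.2))
    · intro h
      exact ((strictMono_claimTime hτ).monotone h).trans ht.1
  rw [claimCount, this, Set.ncard_coe_finset, Nat.card_Icc]
  simp

lemma claimTime_succ (τ : ℕ → ℝ) (n : ℕ) : claimTime τ (n + 1) = claimTime τ n + τ n := by
  rw [claimTime, Finset.sum_range_succ, claimTime]

section Path

variable {c ε u : ℝ} {τ X : ℕ → ℝ} {x : ℝ → ℝ}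

lemma claimTime_nonneg (hτ : ∀ k, 0 < τ k) (n : ℕ) : 0 ≤ claimTime τ n :=
  Finset.sum_nonneg fun k _ => (hτ k).le

/-- Between two claims a surplus path follows the premium flow, and at the next claim it drops by
the claim size. -/
lemma IsSurplusPath.eq_premiumFlow (hτ : ∀ k, 0 < τ k)
    (hx : IsSurplusPath (linearPremium c ε) τ X u x) (n : ℕ) :
    (∀ t ∈ Set.Ico (claimTime τ n) (claimTime τ (n + 1)),
      x t = premiumFlow c ε (x (claimTime τ n)) (t - claimTime τ n)) ∧
    x (claimTime τ (n + 1)) = premiumFlow c ε (x (claimTime τ n)) (τ n) - X n := by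
  have hmono := strictMono_claimTime hτ
  set a := claimTime τ n
  set b := claimTime τ (n + 1)
  have ha0 : 0 ≤ a := claimTime_nonneg hτ n
  have hab : a < b := hmono n.lt_succ_self
  have hb0 : 0 ≤ b := ha0.trans hab.le
  -- `F` is the path on `[a, b)`, extended continuously to `b`.
  set F : ℝ → ℝ := fun t => u + (∫ s in (0 : ℝ)..t, linearPremium c ε (x s))
    - ∑ k ∈ Finset.range n, X k with hFdef
  have hG : ∀ t ∈ Set.Ico a b, x t = F t := by
    intro t ht
    rw [(hx t (ha0.trans ht.1)).2, claimCount_eq hτ ht]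
  have hia := (hx a ha0).1
  have hib := (hx b hb0).1
  have hint : IntervalIntegrable (fun s => c + ε * x s) volume a b := hia.symm.trans hib
  have hF : ∀ t ∈ Set.Icc a b, F t = F a + ∫ s in a..t, (c + ε * x s) := by
    intro t ht
    have := intervalIntegral.integral_add_adjacent_intervals hia
      (hia.symm.trans (hx t (ha0.trans ht.1)).1)
    simp only [hFdef]
    rw [← this]
    simp only [linearPremium]
    ring
  have hxa : x a = F a := hG a ⟨le_rfl, hab⟩
  constructor
  · intro t ht
    rw [hG t ht, hxa]
    exact eq_premiumFlow_of_integral_eq hab.le hint hF hG ⟨ht.1, ht.2.le⟩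
  · have hb := eq_premiumFlow_of_integral_eq hab.le hint hF hG ⟨hab.le, le_rfl⟩
    have hba : b - a = τ n := by
      simp only [a, b, claimTime_succ]; ring
    have hcount : claimCount τ b = n + 1 :=
      claimCount_eq hτ ⟨le_rfl, hmono (n + 1).lt_succ_self⟩
    rw [(hx b hb0).2, hcount, Finset.sum_range_succ, hxa, ← hba, ← hb]
    simp only [hFdef]
    ring

lemma IsSurplusPath.apply_zero (hτ : ∀ k, 0 < τ k)
    (hx : IsSurplusPath (linearPremium c ε) τ X u x) : x 0 = u := by
  have h0 : claimCount τ 0 = 0 := claimCount_eq hτ ⟨by simp [claimTime], by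
    simpa [claimTime] using hτ 0⟩
  have := (hx 0 le_rfl).2
  simpa [h0] using this

/-- Ruin of a path happens at a claim time if it happens at all, because the premium income is
nonnegative as long as the surplus is. -/
lemma IsSurplusPath.ruinTime_lt_top_iff (hc : 0 ≤ c) (hε : 0 ≤ ε) (hτ : ∀ k, 0 < τ k)
    (hlim : Tendsto (claimTime τ) atTop atTop)
    (hx : IsSurplusPath (linearPremium c ε) τ X u x) :
    ruinTime x < ⊤ ↔ ∃ n, stoppedChain c ε τ X u n < 0 := by
  have hchain : ∀ n, 0 ≤ stoppedChain c ε τ X u n →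
      stoppedChain c ε τ X u n = x (claimTime τ n) := by
    intro n
    induction n with
    | zero => intro _; simp [stoppedChain, claimTime, hx.apply_zero hτ]
    | succ n ih =>
      intro h
      by_cases h0 : stoppedChain c ε τ X u n < 0
      · rw [stoppedChain, stoppedStep, if_pos h0] at h
        exact absurd h0 (not_lt.2 h)
      · rw [stoppedChain, stoppedStep, if_neg h0, ih (not_lt.1 h0), (hx.eq_premiumFlow hτ n).2]
  have hneg : ∀ n, stoppedChain c ε τ X u n < 0 → ∃ m, x (claimTime τ m) < 0 := by
    intro n
    induction n with
    | zero => intro h; exact ⟨0, by simpa [stoppedChain, claimTime, hx.apply_zero hτ] using h⟩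
    | succ n ih =>
      intro h
      by_cases h0 : stoppedChain c ε τ X u n < 0
      · exact ih h0
      · rw [stoppedChain, stoppedStep, if_neg h0, hchain n (not_lt.1 h0)] at h
        exact ⟨n + 1, by rw [(hx.eq_premiumFlow hτ n).2]; exact h⟩
  rw [_root_.ruinTime_lt_top_iff]
  constructor
  · rintro ⟨t, ht, hxt⟩
    by_contra! hall
    obtain ⟨m, hm⟩ := ((hlim.eventually_gt_atTop t).exists)
    classical
    have hex : ∃ m, t < claimTime τ m := ⟨m, hm⟩
    obtain ⟨n, hn⟩ : ∃ n, Nat.find hex = n + 1 := by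
      refine Nat.exists_eq_succ_of_ne_zero fun h => ?_
      have := Nat.find_spec hex
      rw [h] at this
      simp [claimTime] at this
      linarith
    have h1 : claimTime τ n ≤ t := not_lt.1 (Nat.find_min hex (by omega))
    have h2 : t < claimTime τ (n + 1) := hn ▸ Nat.find_spec hex
    have h3 := (hx.eq_premiumFlow hτ n).1 t ⟨h1, h2⟩
    have h4 : 0 ≤ x (claimTime τ n) := hchain n (hall n) ▸ hall n
    have h5 := le_premiumFlow hc hε h4 (sub_nonneg.2 h1)
    have h6 : 0 ≤ (c + ε * x (claimTime τ n)) * (t - claimTime τ n) :=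
      mul_nonneg (add_nonneg hc (mul_nonneg hε h4)) (sub_nonneg.2 h1)
    linarith
  · rintro ⟨n, hn⟩
    obtain ⟨m, hm⟩ := hneg n hn
    exact ⟨_, claimTime_nonneg hτ m, hm⟩

end Path

/-! ### The ruin probability as an iterated integral -/

section Prob

variable {Ω : Type*} {c ε u : ℝ} {τ X : ℕ → Ω → ℝ}

lemma measurable_stoppedChain [MeasurableSpace Ω] (n : ℕ) (hτ : ∀ k < n, Measurable (τ k))
    (hX : ∀ k < n, Measurable (X k)) :
    Measurable fun ω => stoppedChain c ε (fun k => τ k ω) (fun k => X k ω) u n := by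
  induction n with
  | zero => exact measurable_const
  | succ n ih =>
    exact (measurable_stoppedStep c ε).comp
      ((ih (fun k hk => hτ k (hk.trans n.lt_succ_self)) fun k hk =>
        hX k (hk.trans n.lt_succ_self)).prodMk
        ((hτ n n.lt_succ_self).prodMk (hX n n.lt_succ_self)))

lemma indepFun_stoppedChain [MeasurableSpace Ω] {P : Measure Ω} (hτ : ∀ k, Measurable (τ k))
    (hX : ∀ k, Measurable (X k)) (hind : iIndepFun (Sum.elim τ X) P) (n : ℕ) :
    IndepFun (fun ω => stoppedChain c ε (fun k => τ k ω) (fun k => X k ω) u n)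
      (fun ω => (τ n ω, X n ω)) P := by
  set m : ℕ ⊕ ℕ → MeasurableSpace Ω :=
    fun i => MeasurableSpace.comap (Sum.elim τ X i) inferInstance with hm
  have hle : ∀ i, m i ≤ ‹MeasurableSpace Ω› := by
    rintro (k | k)
    · exact (hτ k).comap_le
    · exact (hX k).comap_le
  have hdis : Disjoint {i : ℕ ⊕ ℕ | Sum.elim id id i < n} {i | Sum.elim id id i = n} := by
    rw [Set.disjoint_left]
    intro i h1 h2
    simp only [Set.mem_ofPred_eq] at h1 h2
    omega
  have hI := indep_iSup_of_disjoint hle hind hdis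
  have hmeas (S : Set (ℕ ⊕ ℕ)) {i : ℕ ⊕ ℕ} (hi : i ∈ S) :
      Measurable[⨆ i ∈ S, m i] (Sum.elim τ X i) :=
    (comap_measurable (Sum.elim τ X i)).mono (le_iSup₂ (f := fun i (_ : i ∈ S) => m i) i hi) le_rfl
  rw [IndepFun_iff_Indep]
  refine indep_of_indep_of_le_left (indep_of_indep_of_le_right hI ?_) ?_
  · refine Measurable.comap_le ?_
    exact (hmeas {i | Sum.elim id id i = n} (i := Sum.inl n) rfl).prodMk
      (hmeas {i | Sum.elim id id i = n} (i := Sum.inr n) rfl)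
  · refine Measurable.comap_le ?_
    exact @measurable_stoppedChain Ω c ε u τ X (_) n
      (fun k hk => hmeas _ (i := Sum.inl k) hk) (fun k hk => hmeas _ (i := Sum.inr k) hk)

variable [MeasurableSpace Ω] {P : Measure Ω} [IsProbabilityMeasure P] {νT νX : Measure ℝ}

/-- The probability that the stopped chain is negative after `n` claims. -/
lemma measure_stoppedChain_lt_zero (hτ : ∀ k, Measurable (τ k)) (hX : ∀ k, Measurable (X k))
    (lτ : ∀ k, P.map (τ k) = νT) (lX : ∀ k, P.map (X k) = νX)
    (hind : iIndepFun (Sum.elim τ X) P) (n : ℕ) :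
    P {ω | stoppedChain c ε (fun k => τ k ω) (fun k => X k ω) u n < 0}
      = ruinIter c ε νT νX n u := by
  have : IsProbabilityMeasure νT := lτ 0 ▸ Measure.isProbabilityMeasure_map (hτ 0).aemeasurable
  have : IsProbabilityMeasure νX := lX 0 ▸ Measure.isProbabilityMeasure_map (hX 0).aemeasurable
  have hlaw (n : ℕ) : P.map (fun ω => (τ n ω, X n ω)) = νT.prod νX := by
    have h : IndepFun (τ n) (X n) P := hind.indepFun (i := Sum.inl n) (j := Sum.inr n) (by simp)
    rw [(indepFun_iff_map_prod_eq_prod_map_map (hτ n).aemeasurable (hX n).aemeasurable).1 h,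
      lτ n, lX n]
  have hC (n : ℕ) := measurable_stoppedChain (c := c) (ε := ε) (u := u) n (fun k _ => hτ k)
    (fun k _ => hX k)
  have hstep (n : ℕ) {f : ℝ → ℝ≥0∞} (hf : Measurable f) :
      ∫⁻ ω, f (stoppedChain c ε (fun k => τ k ω) (fun k => X k ω) u (n + 1)) ∂P
        = ∫⁻ ω, ruinOp c ε νT νX f
            (stoppedChain c ε (fun k => τ k ω) (fun k => X k ω) u n) ∂P := by
    have hF : Measurable fun q : ℝ × (ℝ × ℝ) => f (stoppedStep c ε q.1 q.2) :=
      hf.comp (measurable_stoppedStep c ε)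
    have hZ : Measurable fun ω => (τ n ω, X n ω) := (hτ n).prodMk (hX n)
    have h := (indepFun_iff_map_prod_eq_prod_map_map (hC n).aemeasurable hZ.aemeasurable).1
      (indepFun_stoppedChain (c := c) (ε := ε) (u := u) hτ hX hind n)
    have h1 := lintegral_map (μ := P) hF ((hC n).prodMk hZ)
    rw [h, hlaw n, lintegral_prod _ hF.aemeasurable, lintegral_map _ (hC n)] at h1
    · exact h1.symm
    · exact Measurable.lintegral_prod_right' hF
  have key (n : ℕ) : ∀ k, ∫⁻ ω, ruinIter c ε νT νX k
      (stoppedChain c ε (fun k => τ k ω) (fun k => X k ω) u n) ∂P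
        = ruinIter c ε νT νX (n + k) u := by
    induction n with
    | zero => intro k; simp [stoppedChain]
    | succ n ih =>
      intro k
      rw [hstep n (measurable_ruinIter k), ← ruinIter_succ, ih (k + 1)]
      congr 1; omega
  have := key n 0
  rw [add_zero] at this
  rw [← this]
  have hS : MeasurableSet {ω | stoppedChain c ε (fun k => τ k ω) (fun k => X k ω) u n < 0} :=
    measurableSet_lt (hC n) measurable_const
  rw [← lintegral_indicator_one hS]
  rfl

/-- Positive i.i.d. interclaim times have a divergent sum: this is the strong law of large numbers
for their truncations at `1`. -/
lemma tendsto_claimTime_atTop (hτ : ∀ k, Measurable (τ k)) (lτ : ∀ k, P.map (τ k) = νT)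
    (hT : ∀ᵐ t ∂νT, 0 < t) (hind : iIndepFun τ P) :
    ∀ᵐ ω ∂P, Tendsto (claimTime fun k => τ k ω) atTop atTop := by
  have hpos (k : ℕ) : ∀ᵐ ω ∂P, 0 < τ k ω :=
    ae_of_ae_map (hτ k).aemeasurable (by rw [lτ k]; exact hT)
  set Y : ℕ → Ω → ℝ := fun k ω => min (τ k ω) 1
  have hYm (k : ℕ) : Measurable (Y k) := (hτ k).min measurable_const
  have hYpos : ∀ᵐ ω ∂P, 0 < Y 0 ω := by
    filter_upwards [hpos 0] with ω hω
    exact lt_min hω one_pos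
  have hYi : Integrable (Y 0) P := by
    refine Integrable.of_bound (hYm 0).aestronglyMeasurable 1 ?_
    filter_upwards [hYpos] with ω hω
    rw [Real.norm_of_nonneg hω.le]
    exact min_le_right _ _
  have hslln := strong_law_ae_real Y hYi
    (fun i j hij => (hind.indepFun hij).comp (φ := fun t : ℝ => min t 1) (ψ := fun t : ℝ => min t 1)
      (by fun_prop) (by fun_prop))
    (fun i => IdentDistrib.comp (u := fun t : ℝ => min t 1)
      ⟨(hτ i).aemeasurable, (hτ 0).aemeasurable, by rw [lτ, lτ]⟩ (by fun_prop))
  have hE : 0 < ∫ ω, Y 0 ω ∂P := by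
    rw [integral_pos_iff_support_of_nonneg_ae (hYpos.mono fun _ h => h.le) hYi]
    have : P (Function.support (Y 0)) = 1 := by
      rw [prob_compl_eq_zero_iff (measurableSet_support (hYm 0)) |>.symm]
      refine measure_mono_null (fun ω hω => ?_) hYpos
      simp only [Set.mem_compl_iff, Function.mem_support, not_not] at hω
      simp [hω]
    simp [this]
  filter_upwards [hslln] with ω hω
  have h1 : Tendsto (fun n : ℕ => ∑ i ∈ Finset.range n, Y i ω) atTop atTop := by
    have h2 := hω.pos_mul_atTop hE tendsto_natCast_atTop_atTop
    refine h2.congr' ?_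
    filter_upwards [eventually_ne_atTop 0] with n hn
    field_simp
  refine tendsto_atTop_mono (fun n => ?_) h1
  exact Finset.sum_le_sum fun k _ => min_le_left _ _

end Prob

lemma RiskModel.ruinProb_nonneg {νT νX : Measure ℝ} {p : ℝ → ℝ} (M : RiskModel νT νX p) (u : ℝ) :
    0 ≤ M.ruinProb u :=
  measureReal_nonneg

/-- The ruin probability of a risk model depends on the laws of the interclaim times and claim sizes
only, and it is the limit of the iterates of the ruin operator. -/
lemma RiskModel.ofReal_ruinProb {νT νX : Measure ℝ} {p : ℝ → ℝ} (M : RiskModel νT νX p) {c ε : ℝ}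
    (hp : p = linearPremium c ε) (hc : 0 ≤ c) (hε : 0 ≤ ε) (hT : ∀ᵐ t ∂νT, 0 < t) {u : ℝ}
    (hu : 0 ≤ u) : ENNReal.ofReal (M.ruinProb u) = ruinValue c ε νT νX u := by
  subst hp
  have : IsProbabilityMeasure νT :=
    M.law_τ 0 ▸ Measure.isProbabilityMeasure_map (M.measurable_τ 0).aemeasurable
  have : IsProbabilityMeasure νX :=
    M.law_X 0 ▸ Measure.isProbabilityMeasure_map (M.measurable_X 0).aemeasurable
  have hpos : ∀ᵐ ω ∂M.P, ∀ k, 0 < M.τ k ω := ae_all_iff.2 fun k =>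
    ae_of_ae_map (M.measurable_τ k).aemeasurable (by rw [M.law_τ k]; exact hT)
  have hlim := tendsto_claimTime_atTop M.measurable_τ M.law_τ hT
    (M.indep.precomp (g := Sum.inl) (f := Sum.elim M.τ M.X) Sum.inl_injective)
  have hset : {ω | ruinTime (fun t => M.U u t ω) < ⊤} =ᵐ[M.P]
      ⋃ n, {ω | stoppedChain c ε (fun k => M.τ k ω) (fun k => M.X k ω) u n < 0} := by
    refine eventuallyEq_set.2 ?_
    filter_upwards [hpos, hlim, M.surplus u hu] with ω h1 h2 h3
    have := h3.ruinTime_lt_top_iff hc hε h1 h2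
    simpa [Set.mem_iUnion] using this
  have hmono : Monotone fun n =>
      {ω | stoppedChain c ε (fun k => M.τ k ω) (fun k => M.X k ω) u n < 0} := by
    refine monotone_nat_of_le_succ fun n => Set.ofPred_subset_ofPred.2 fun ω hω => ?_
    rwa [stoppedChain, stoppedStep, if_pos hω]
  rw [RiskModel.ruinProb, Measure.real, ENNReal.ofReal_toReal (measure_ne_top _ _),
    measure_congr hset, hmono.measure_iUnion, ruinValue]
  congr 1
  ext n
  exact measure_stoppedChain_lt_zero M.measurable_τ M.measurable_X M.law_τ M.law_X M.indep n

/-! ### Exponential moments and tails of gamma distributions -/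

section Gamma

variable {a r R : ℝ}

lemma measurable_gammaPDF (a r : ℝ) : Measurable (gammaPDF a r) :=
  (measurable_gammaPDFReal a r).ennreal_ofReal

lemma lintegral_gammaMeasure {f : ℝ → ℝ≥0∞} (hf : Measurable f) :
    ∫⁻ x, f x ∂gammaMeasure a r = ∫⁻ x, gammaPDF a r x * f x := by
  rw [gammaMeasure, lintegral_withDensity_eq_lintegral_mul _
    (measurable_gammaPDF a r) hf]
  rfl

/-- Exponential tilting of a gamma density gives a multiple of a gamma density. -/
lemma gammaPDF_mul_exp (hr : 0 < r) (hR : R < r) (x : ℝ) :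
    gammaPDF a r x * ENNReal.ofReal (Real.exp (R * x))
      = ENNReal.ofReal ((r / (r - R)) ^ a) * gammaPDF a (r - R) x := by
  rcases lt_or_ge x 0 with hx | hx
  · simp [gammaPDF_of_neg hx]
  · rw [gammaPDF_of_nonneg hx, gammaPDF_of_nonneg hx, ← ENNReal.ofReal_mul' (Real.exp_pos _).le,
      ← ENNReal.ofReal_mul (by have := sub_pos.2 hR; positivity),
      Real.div_rpow hr.le (sub_pos.2 hR).le]
    congr 1
    have h1 : Real.exp (-((r - R) * x)) = Real.exp (-(r * x)) * Real.exp (R * x) := by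
      rw [← Real.exp_add]; ring_nf
    have h2 : (r - R) ^ a ≠ 0 := (Real.rpow_pos_of_pos (sub_pos.2 hR) a).ne'
    rw [h1]
    field_simp

lemma setLIntegral_exp_gammaMeasure (hr : 0 < r) (hR : R < r) {s : Set ℝ} (hs : MeasurableSet s) :
    ∫⁻ x in s, ENNReal.ofReal (Real.exp (R * x)) ∂gammaMeasure a r
      = ENNReal.ofReal ((r / (r - R)) ^ a) * gammaMeasure a (r - R) s := by
  rw [gammaMeasure, gammaMeasure, withDensity_apply _ hs,
    setLIntegral_withDensity_eq_setLIntegral_mul _ (measurable_gammaPDF a r)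
    (by fun_prop) hs, ← lintegral_const_mul _ (measurable_gammaPDF a (r - R))]
  exact lintegral_congr fun x => gammaPDF_mul_exp hr hR x

lemma lintegral_exp_gammaMeasure (ha : 0 < a) (hr : 0 < r) (hR : R < r) :
    ∫⁻ x, ENNReal.ofReal (Real.exp (R * x)) ∂gammaMeasure a r
      = ENNReal.ofReal ((r / (r - R)) ^ a) := by
  have := isProbabilityMeasure_gammaMeasure ha (sub_pos.2 hR)
  rw [← setLIntegral_univ, setLIntegral_exp_gammaMeasure hr hR MeasurableSet.univ]
  simp

lemma ae_pos_gammaMeasure : ∀ᵐ t ∂gammaMeasure a r, 0 < t := by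
  rw [gammaMeasure, ae_withDensity_iff (measurable_gammaPDF a r)]
  have hne : ∀ᵐ t ∂(volume : Measure ℝ), t ≠ 0 := by simp [ae_iff]
  filter_upwards [hne] with t ht h
  by_contra! hneg
  exact h (gammaPDF_of_neg (lt_of_le_of_ne hneg ht))

/-- The integral of a nonnegative derivative over a half-line. -/
lemma setLIntegral_Ioi_deriv {g g' : ℝ → ℝ} {y : ℝ}
    (hg : ∀ x ∈ Set.Ici y, HasDerivAt g (g' x) x) (hpos : ∀ x ∈ Set.Ioi y, 0 ≤ g' x)
    (hlim : Tendsto g atTop (𝓝 0)) :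
    ∫⁻ x in Set.Ioi y, ENNReal.ofReal (g' x) = ENNReal.ofReal (-g y) := by
  have hc := (hg y Set.self_mem_Ici).continuousAt.continuousWithinAt (s := Set.Ici y)
  have hd : ∀ x ∈ Set.Ioi y, HasDerivAt g (g' x) x := fun x hx => hg x (Set.Ioi_subset_Ici_self hx)
  rw [← ofReal_integral_eq_lintegral_ofReal (integrableOn_Ioi_deriv_of_nonneg hc hd hpos hlim)
    ((ae_restrict_iff' measurableSet_Ioi).2 (ae_of_all _ hpos)),
    integral_Ioi_of_hasDerivAt_of_nonneg hc hd hpos hlim, zero_sub]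

lemma gammaMeasure_one_Ioi (hr : 0 < r) {y : ℝ} (hy : 0 ≤ y) :
    gammaMeasure 1 r (Set.Ioi y) = ENNReal.ofReal (Real.exp (-(r * y))) := by
  have h := setLIntegral_Ioi_deriv (y := y) (g := fun x => -Real.exp (-(r * x)))
    (g' := fun x => r * Real.exp (-(r * x))) (fun x _ => by
      refine ((hasDerivAt_id x).const_mul r).neg.exp.neg.congr_deriv ?_
      simp only [id, mul_one, Pi.neg_apply]
      ring) (fun x _ => by positivity) (by
      have := Real.tendsto_exp_neg_atTop_nhds_zero.comp (tendsto_id.const_mul_atTop hr)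
      simpa [Function.comp_def] using this.neg)
  rw [neg_neg] at h
  rw [← h, gammaMeasure, withDensity_apply _ measurableSet_Ioi]
  refine setLIntegral_congr_fun measurableSet_Ioi fun x hx => ?_
  rw [gammaPDF_of_nonneg (hy.trans (le_of_lt hx))]
  simp

lemma gammaPDF_two_of_nonneg {x : ℝ} (hx : 0 ≤ x) :
    gammaPDF 2 r x = ENNReal.ofReal (r ^ 2 * x * Real.exp (-(r * x))) := by
  rw [gammaPDF_of_nonneg hx, Real.Gamma_two, show (2 : ℝ) - 1 = 1 by norm_num, Real.rpow_one,
    Real.rpow_two, div_one]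

lemma gammaMeasure_two_Ioi (hr : 0 < r) {y : ℝ} (hy : 0 ≤ y) :
    gammaMeasure 2 r (Set.Ioi y) = ENNReal.ofReal ((1 + r * y) * Real.exp (-(r * y))) := by
  have h := setLIntegral_Ioi_deriv (y := y) (g := fun x => -((1 + r * x) * Real.exp (-(r * x))))
    (g' := fun x => r ^ 2 * x * Real.exp (-(r * x))) (fun x _ => by
      have h1 := ((hasDerivAt_id x).const_mul r).neg.exp
      have h2 := ((hasDerivAt_id x).const_mul r).const_add 1
      refine (h2.mul h1).neg.congr_deriv ?_
      simp only [id, mul_one, Pi.neg_apply]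
      ring) (fun x hx => by
        have : 0 ≤ x := hy.trans (le_of_lt hx)
        positivity) (by
      have h1 := Real.tendsto_exp_neg_atTop_nhds_zero.comp (tendsto_id.const_mul_atTop hr)
      have h2 := (Real.tendsto_pow_mul_exp_neg_atTop_nhds_zero 1).comp
        (tendsto_id.const_mul_atTop hr)
      simpa [Function.comp_def, add_mul] using (h1.add h2).neg)
  rw [neg_neg] at h
  rw [← h, gammaMeasure, withDensity_apply _ measurableSet_Ioi]
  exact setLIntegral_congr_fun measurableSet_Ioi fun x hx =>
    gammaPDF_two_of_nonneg (hy.trans (le_of_lt hx))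

end Gamma

/-! ### Lundberg bounds for a constant premium -/

section Lundberg

variable {c K R : ℝ} {νT νX : Measure ℝ}

/-- The function equal to `K e^{-R y}` on nonnegative surpluses and to `1` on negative ones. -/
noncomputable def lundbergFun (K R y : ℝ) : ℝ≥0∞ :=
  if y < 0 then 1 else ENNReal.ofReal (K * Real.exp (-(R * y)))

lemma measurable_lundbergFun (K R : ℝ) : Measurable (lundbergFun K R) :=
  Measurable.ite measurableSet_Iio measurable_const (by fun_prop)

lemma premiumFlow_zero (c y t : ℝ) : premiumFlow c 0 y t = y + c * t := by
  simp [premiumFlow]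

lemma lintegral_lundbergFun_sub (z : ℝ) :
    ∫⁻ x, lundbergFun K R (z - x) ∂νX = νX (Set.Ioi z)
      + ENNReal.ofReal K * ∫⁻ x in Set.Iic z, ENNReal.ofReal (Real.exp (R * (x - z))) ∂νX := by
  rw [← lintegral_add_compl _ (measurableSet_Ioi (a := z)), Set.compl_Ioi,
    ← lintegral_const_mul _ (by fun_prop)]
  congr 1
  · rw [← setLIntegral_one]
    refine setLIntegral_congr_fun measurableSet_Ioi fun x hx => ?_
    simp [lundbergFun, Set.mem_Ioi.1 hx]
  · refine setLIntegral_congr_fun measurableSet_Iic fun x hx => ?_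
    rw [lundbergFun, if_neg (by simpa using hx), ENNReal.ofReal_mul' (Real.exp_pos _).le]
    ring_nf

lemma lintegral_exp_sub_split (z : ℝ) :
    ENNReal.ofReal (Real.exp (-(R * z))) * ∫⁻ x, ENNReal.ofReal (Real.exp (R * x)) ∂νX
      = (∫⁻ x in Set.Ioi z, ENNReal.ofReal (Real.exp (R * (x - z))) ∂νX)
        + ∫⁻ x in Set.Iic z, ENNReal.ofReal (Real.exp (R * (x - z))) ∂νX := by
  rw [← Set.compl_Ioi, lintegral_add_compl _ measurableSet_Ioi,
    ← lintegral_const_mul _ (by fun_prop)]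
  refine lintegral_congr fun x => ?_
  rw [← ENNReal.ofReal_mul (Real.exp_pos _).le, ← Real.exp_add]
  ring_nf

lemma lintegral_ofReal_exp_premium (K y : ℝ) (m : ℝ≥0∞) :
    ∫⁻ t, ENNReal.ofReal K * (ENNReal.ofReal (Real.exp (-(R * (y + c * t)))) * m) ∂νT
      = ENNReal.ofReal (K * Real.exp (-(R * y)))
        * ((∫⁻ t, ENNReal.ofReal (Real.exp (-(R * c) * t)) ∂νT) * m) := by
  rw [← lintegral_mul_const _ (by fun_prop), ← lintegral_const_mul _ (by fun_prop)]
  refine lintegral_congr fun t => ?_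
  have h : Real.exp (-(R * (y + c * t))) = Real.exp (-(R * y)) * Real.exp (-(R * c) * t) := by
    rw [← Real.exp_add]; ring_nf
  rw [ENNReal.ofReal_mul' (Real.exp_pos _).le, h, ENNReal.ofReal_mul (Real.exp_pos _).le]
  ring

lemma lundbergFun_le_ruinOp [IsProbabilityMeasure νT] [IsProbabilityMeasure νX] (hc : 0 ≤ c)
    (hT : ∀ᵐ t ∂νT, 0 < t)
    (htail : ∀ z, 0 ≤ z → ENNReal.ofReal K *
      ∫⁻ x in Set.Ioi z, ENNReal.ofReal (Real.exp (R * (x - z))) ∂νX ≤ νX (Set.Ioi z))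
    (hmgf : 1 ≤ (∫⁻ t, ENNReal.ofReal (Real.exp (-(R * c) * t)) ∂νT)
      * ∫⁻ x, ENNReal.ofReal (Real.exp (R * x)) ∂νX) :
    lundbergFun K R ≤ ruinOp c 0 νT νX (lundbergFun K R) := by
  intro y
  rcases lt_or_ge y 0 with hy | hy
  · rw [ruinOp_of_neg _ hy]
  rw [ruinOp_of_nonneg (measurable_lundbergFun K R) hy]
  calc lundbergFun K R y = ENNReal.ofReal (K * Real.exp (-(R * y))) * 1 := by
        rw [lundbergFun, if_neg (not_lt.2 hy), mul_one]
    _ ≤ _ := mul_le_mul_right hmgf _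
    _ = _ := (lintegral_ofReal_exp_premium K y _).symm
    _ ≤ _ := by
      refine lintegral_mono_ae ?_
      filter_upwards [hT] with t ht
      rw [premiumFlow_zero, lintegral_lundbergFun_sub, lintegral_exp_sub_split, mul_add]
      gcongr
      exact htail _ (by positivity)

lemma ruinOp_lundbergFun_le [IsProbabilityMeasure νT] [IsProbabilityMeasure νX] (hc : 0 ≤ c)
    (hT : ∀ᵐ t ∂νT, 0 < t)
    (htail : ∀ z, 0 ≤ z → νX (Set.Ioi z) ≤ ENNReal.ofReal K *
      ∫⁻ x in Set.Ioi z, ENNReal.ofReal (Real.exp (R * (x - z))) ∂νX)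
    (hmgf : (∫⁻ t, ENNReal.ofReal (Real.exp (-(R * c) * t)) ∂νT)
      * ∫⁻ x, ENNReal.ofReal (Real.exp (R * x)) ∂νX ≤ 1) :
    ruinOp c 0 νT νX (lundbergFun K R) ≤ lundbergFun K R := by
  intro y
  rcases lt_or_ge y 0 with hy | hy
  · rw [ruinOp_of_neg _ hy]
  rw [ruinOp_of_nonneg (measurable_lundbergFun K R) hy]
  calc _ ≤ _ := by
        refine lintegral_mono_ae (g := fun t => ENNReal.ofReal K *
          (ENNReal.ofReal (Real.exp (-(R * (y + c * t)))) *
            ∫⁻ x, ENNReal.ofReal (Real.exp (R * x)) ∂νX)) ?_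
        filter_upwards [hT] with t ht
        rw [premiumFlow_zero, lintegral_lundbergFun_sub, lintegral_exp_sub_split, mul_add]
        gcongr
        exact htail _ (by positivity)
    _ = _ := lintegral_ofReal_exp_premium K y _
    _ ≤ ENNReal.ofReal (K * Real.exp (-(R * y))) * 1 := mul_le_mul_right hmgf _
    _ = lundbergFun K R y := by rw [lundbergFun, if_neg (not_lt.2 hy), mul_one]

/-- The Lundberg lower bound. The exponent `R'` at which the increments of the surplus have
exponential moment below `1` replaces the argument that the surplus tends to infinity on
survival. -/
lemma lundbergFun_le_ruinValue [IsProbabilityMeasure νT] [IsProbabilityMeasure νX] (hc : 0 ≤ c)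
    (hT : ∀ᵐ t ∂νT, 0 < t) {R' : ℝ} (hR' : R' ≤ R) (hK : 0 ≤ K)
    (htail : ∀ z, 0 ≤ z → ENNReal.ofReal K *
      ∫⁻ x in Set.Ioi z, ENNReal.ofReal (Real.exp (R * (x - z))) ∂νX ≤ νX (Set.Ioi z))
    (hmgf : 1 ≤ (∫⁻ t, ENNReal.ofReal (Real.exp (-(R * c) * t)) ∂νT)
      * ∫⁻ x, ENNReal.ofReal (Real.exp (R * x)) ∂νX)
    (hmgf' : (∫⁻ t, ENNReal.ofReal (Real.exp (-(R' * c) * t)) ∂νT)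
      * ∫⁻ x, ENNReal.ofReal (Real.exp (R' * x)) ∂νX < 1) (y : ℝ) :
    lundbergFun K R y ≤ ruinValue c 0 νT νX y := by
  set G : ℝ → ℝ≥0∞ := fun y => ENNReal.ofReal (K * Real.exp (-(R' * y))) with hG
  set g : ℝ → ℝ≥0∞ := (Set.Ici 0).indicator G with hg
  have hgm : Measurable g := Measurable.indicator (by fun_prop) measurableSet_Ici
  refine le_ruinValue_of_le_ruinOp (g := g) ?_ (lundbergFun_le_ruinOp hc hT htail hmgf) hmgf' ?_ ?_
  · intro y
    rcases lt_or_ge y 0 with hy | hy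
    · simp [lundbergFun, hy, hg]
    · simp only [lundbergFun, if_neg (not_lt.2 hy), Pi.add_apply, hg]
      rw [Set.indicator_of_mem (Set.mem_Ici.2 hy)]
      refine le_add_left (ENNReal.ofReal_le_ofReal ?_)
      have := mul_le_mul_of_nonneg_right hR' hy
      gcongr
  · intro y
    rcases lt_or_ge y 0 with hy | hy
    · rw [ruinOp_of_neg _ hy]; simp [hg, hy]
    · rw [ruinOp_of_nonneg hgm hy]
      calc _ ≤ ∫⁻ t, ENNReal.ofReal K * (ENNReal.ofReal (Real.exp (-(R' * (y + c * t)))) *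
            ∫⁻ x, ENNReal.ofReal (Real.exp (R' * x)) ∂νX) ∂νT := by
            refine lintegral_mono fun t => ?_
            rw [premiumFlow_zero, ← lintegral_const_mul _ (by fun_prop),
              ← lintegral_const_mul _ (by fun_prop)]
            refine lintegral_mono fun x => (Set.indicator_le_self _ _ _).trans (le_of_eq ?_)
            rw [← ENNReal.ofReal_mul (Real.exp_pos _).le, ← Real.exp_add, ← ENNReal.ofReal_mul hK]
            simp only [hG]
            ring_nf
        _ = _ := lintegral_ofReal_exp_premium K y _
        _ = _ := by
            rw [mul_comm, Pi.smul_apply, smul_eq_mul, hg, Set.indicator_of_mem (Set.mem_Ici.2 hy)]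
  · exact ne_top_of_le_ne_top ENNReal.ofReal_ne_top (Set.indicator_le_self _ G y)

end Lundberg

section GammaLundberg

variable {a b lam mu c R : ℝ}

lemma lintegral_exp_mul_lintegral_exp_gammaMeasure (ha : 0 < a) (hb : 0 < b) (hlam : 0 < lam)
    (hmu : 0 < mu) (hc : 0 < c) (hR : 0 < R) (hRmu : R < mu) :
    (∫⁻ t, ENNReal.ofReal (Real.exp (-(R * c) * t)) ∂gammaMeasure a lam)
      * ∫⁻ x, ENNReal.ofReal (Real.exp (R * x)) ∂gammaMeasure b mu
      = ENNReal.ofReal ((lam / (lam + R * c)) ^ a * (mu / (mu - R)) ^ b) := by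
  have h := mul_pos hR hc
  rw [lintegral_exp_gammaMeasure ha hlam (by linarith), lintegral_exp_gammaMeasure hb hmu hRmu,
    ← ENNReal.ofReal_mul (by rw [sub_neg_eq_add]; positivity), sub_neg_eq_add]

/-- With the constant `K = ((μ - R) / μ)^b`, the tail condition of the Lundberg bounds compares the
claim size law with its exponential tilting. -/
lemma mul_setLIntegral_Ioi_exp_gammaMeasure (hmu : 0 < mu) (hRmu : R < mu) (z : ℝ) :
    ENNReal.ofReal (((mu - R) / mu) ^ b) *
      ∫⁻ x in Set.Ioi z, ENNReal.ofReal (Real.exp (R * (x - z))) ∂gammaMeasure b mu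
      = ENNReal.ofReal (Real.exp (-(R * z))) * gammaMeasure b (mu - R) (Set.Ioi z) := by
  have hs := sub_pos.2 hRmu
  have h1 : ∫⁻ x in Set.Ioi z, ENNReal.ofReal (Real.exp (R * (x - z))) ∂gammaMeasure b mu
      = ENNReal.ofReal (Real.exp (-(R * z))) *
        ∫⁻ x in Set.Ioi z, ENNReal.ofReal (Real.exp (R * x)) ∂gammaMeasure b mu := by
    rw [← lintegral_const_mul _ (by fun_prop)]
    refine lintegral_congr fun x => ?_
    rw [← ENNReal.ofReal_mul (Real.exp_pos _).le, ← Real.exp_add]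
    ring_nf
  have h2 : ((mu - R) / mu) ^ b * (mu / (mu - R)) ^ b = 1 := by
    rw [← Real.mul_rpow (by positivity) (by positivity), div_mul_div_cancel₀ hmu.ne',
      div_self hs.ne', Real.one_rpow]
  rw [h1, setLIntegral_exp_gammaMeasure hmu hRmu measurableSet_Ioi, mul_left_comm, ← mul_assoc
    (ENNReal.ofReal (((mu - R) / mu) ^ b)), ← ENNReal.ofReal_mul (by positivity), h2,
    ENNReal.ofReal_one, one_mul]

/-- The adjustment coefficient of the model with Erlang(2, `lam`) interclaim times, Exp(`mu`) claims
and premium rate `c`. -/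
noncomputable def adjustCoeff (lam mu c : ℝ) : ℝ :=
  (c * mu - 2 * lam + Real.sqrt (c ^ 2 * mu ^ 2 + 4 * c * lam * mu)) / (2 * c)

lemma adjustCoeff_pos (hlam : 0 < lam) (hc : 0 < c) (hnet : lam < 2 * c * mu) :
    0 < adjustCoeff lam mu c := by
  have h : 2 * lam - c * mu < Real.sqrt (c ^ 2 * mu ^ 2 + 4 * c * lam * mu) := by
    refine Real.lt_sqrt_of_sq_lt ?_
    nlinarith [mul_pos hlam (sub_pos.2 hnet)]
  exact div_pos (by linarith) (by linarith)

lemma adjustCoeff_lt (hlam : 0 < lam) (hmu : 0 < mu) (hc : 0 < c) : adjustCoeff lam mu c < mu := by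
  have h : Real.sqrt (c ^ 2 * mu ^ 2 + 4 * c * lam * mu) < c * mu + 2 * lam := by
    rw [Real.sqrt_lt' (by positivity)]
    nlinarith [mul_pos hlam hlam]
  rw [adjustCoeff, div_lt_iff₀ (by linarith)]
  linarith

lemma adjustCoeff_quadratic (hlam : 0 < lam) (hmu : 0 < mu) (hc : 0 < c) :
    c ^ 2 * adjustCoeff lam mu c ^ 2 + (2 * lam * c - mu * c ^ 2) * adjustCoeff lam mu c
      + lam ^ 2 - 2 * lam * c * mu = 0 := by
  have hs := Real.sq_sqrt (by positivity : 0 ≤ c ^ 2 * mu ^ 2 + 4 * c * lam * mu)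
  have h2 : 2 * c * adjustCoeff lam mu c
      = c * mu - 2 * lam + Real.sqrt (c ^ 2 * mu ^ 2 + 4 * c * lam * mu) := by
    rw [adjustCoeff]; field_simp
  generalize Real.sqrt (c ^ 2 * mu ^ 2 + 4 * c * lam * mu) = s at hs h2
  have h3 : s = 2 * c * adjustCoeff lam mu c - c * mu + 2 * lam := by linarith
  rw [h3] at hs
  linarith

/-- The ruin probability for exponential claims and a constant premium is an exact exponential. -/
lemma ruinValue_const_expMeasure (hlam : 0 < lam) (hmu : 0 < mu) (hc : 0 < c)
    (hnet : lam < 2 * c * mu) {y : ℝ} (hy : 0 ≤ y) :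
    ruinValue c 0 (erlangTwo lam) (expMeasure mu) y
      = ENNReal.ofReal ((mu - adjustCoeff lam mu c) / mu
        * Real.exp (-(adjustCoeff lam mu c * y))) := by
  have hR0 := adjustCoeff_pos hlam hc hnet
  have hRmu := adjustCoeff_lt hlam hmu hc
  have hq := adjustCoeff_quadratic hlam hmu hc
  set R := adjustCoeff lam mu c
  have hs := sub_pos.2 hRmu
  rw [erlangTwo, expMeasure]
  have := isProbabilityMeasure_gammaMeasure two_pos hlam
  have := isProbabilityMeasure_gammaMeasure one_pos hmu
  have htail : ∀ z, 0 ≤ z → ENNReal.ofReal ((mu - R) / mu) * ∫⁻ x in Set.Ioi z,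
      ENNReal.ofReal (Real.exp (R * (x - z))) ∂gammaMeasure 1 mu
        = gammaMeasure 1 mu (Set.Ioi z) := by
    intro z hz
    have h := mul_setLIntegral_Ioi_exp_gammaMeasure (b := 1) hmu hRmu z
    rw [Real.rpow_one] at h
    rw [h, gammaMeasure_one_Ioi hs hz, gammaMeasure_one_Ioi hmu hz,
      ← ENNReal.ofReal_mul (Real.exp_pos _).le, ← Real.exp_add]
    ring_nf
  have hmgf : (∫⁻ t, ENNReal.ofReal (Real.exp (-(R * c) * t)) ∂gammaMeasure 2 lam)
      * ∫⁻ x, ENNReal.ofReal (Real.exp (R * x)) ∂gammaMeasure 1 mu = 1 := by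
    rw [lintegral_exp_mul_lintegral_exp_gammaMeasure two_pos one_pos hlam hmu hc hR0 hRmu,
      Real.rpow_two, Real.rpow_one, ENNReal.ofReal_eq_one]
    have : lam + R * c ≠ 0 := by positivity
    field_simp
    linear_combination R * hq
  have hmgf' : (∫⁻ t, ENNReal.ofReal (Real.exp (-(R / 2 * c) * t)) ∂gammaMeasure 2 lam)
      * ∫⁻ x, ENNReal.ofReal (Real.exp (R / 2 * x)) ∂gammaMeasure 1 mu < 1 := by
    have hs' : 0 < mu - R / 2 := by linarith
    rw [lintegral_exp_mul_lintegral_exp_gammaMeasure two_pos one_pos hlam hmu hc (half_pos hR0)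
      (by linarith), Real.rpow_two, Real.rpow_one, ENNReal.ofReal_lt_one, div_pow,
      div_mul_div_comm, div_lt_one (by positivity)]
    -- the difference is `R / 2` times the concave quadratic `q` with `q R = 0 < q 0`, at `R / 2`
    have h1 : 0 < R / 2 * (c ^ 2 * R ^ 2 / 4 + lam * (2 * c * mu - lam) / 2) := by
      have := mul_pos hlam (sub_pos.2 hnet)
      positivity
    linear_combination h1 + R / 4 * hq
  have hK : lundbergFun ((mu - R) / mu) R y
      = ENNReal.ofReal ((mu - R) / mu * Real.exp (-(R * y))) := by
    rw [lundbergFun, if_neg (not_lt.2 hy)]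
  rw [← hK]
  refine le_antisymm ?_ ?_
  · refine ruinValue_le_of_ruinOp_le ?_ (ruinOp_lundbergFun_le hc.le ae_pos_gammaMeasure
      (fun z hz => (htail z hz).ge) hmgf.le) y
    exact Set.indicator_le fun x hx => by simp [lundbergFun, Set.mem_Iio.1 hx]
  · exact lundbergFun_le_ruinValue hc.le ae_pos_gammaMeasure (half_le_self hR0.le)
      (by positivity) (fun z hz => (htail z hz).le) hmgf.ge hmgf' y

/-- For Erlang claims and any constant premium, the ruin probability decays at an exponential rate
strictly below that of the claim sizes. The rate `R` is the adjustment coefficient for a larger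
premium `c'`, under which the net profit condition holds. -/
lemma exists_le_ruinValue_const_erlangTwo (hlam : 0 < lam) (hmu : 0 < mu) (hc : 0 < c) :
    ∃ R K : ℝ, 0 < R ∧ R < mu ∧ 0 < K ∧ ∀ y, 0 ≤ y → ENNReal.ofReal (K * Real.exp (-(R * y)))
      ≤ ruinValue c 0 (expMeasure lam) (erlangTwo mu) y := by
  have := isProbabilityMeasure_gammaMeasure two_pos hmu
  have := isProbabilityMeasure_gammaMeasure one_pos hlam
  set s : ℝ := mu * lam / (2 * (lam + c * mu)) with hs_def
  have hs0 : 0 < s := by positivity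
  have hsmu : s ≤ mu / 2 := by
    rw [hs_def, div_le_div_iff₀ (by positivity) two_pos]
    have : 0 < mu * (c * mu) := by positivity
    nlinarith
  have hsc : c * s ^ 2 ≤ lam * mu := by
    have h1 : c * s ≤ lam := by
      rw [hs_def, mul_div_assoc', div_le_iff₀ (by positivity)]
      have : 0 < lam * (lam + c * mu) := by positivity
      nlinarith [mul_pos hlam hlam]
    nlinarith
  set R : ℝ := mu - s with hR_def
  have hR0 : 0 < R := by linarith
  have hRmu : R < mu := by linarith
  have hmuR : mu - R = s := by rw [hR_def]; ring
  set c' : ℝ := lam * (2 * mu - R) / (mu - R) ^ 2 with hc'_def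
  have hc'eq : c' * (mu - R) ^ 2 = lam * (2 * mu - R) := by
    rw [hc'_def, hmuR]; field_simp
  have hcc' : c ≤ c' := by
    rw [hc'_def, hmuR, le_div_iff₀ (by positivity)]
    nlinarith
  have hc' : 0 < c' := hc.trans_le hcc'
  refine ⟨R, ((mu - R) / mu) ^ (2 : ℝ), hR0, hRmu, by rw [hmuR]; positivity, fun y hy => ?_⟩
  rw [erlangTwo, expMeasure]
  refine le_trans ?_ (ruinValue_anti_premium (c' := c')
    (ae_pos_gammaMeasure.mono fun _ h => le_of_lt h) hcc' le_rfl y)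
  have h := lundbergFun_le_ruinValue (c := c') (K := ((mu - R) / mu) ^ (2 : ℝ)) (R := R)
    (R' := R / 2) (νT := gammaMeasure 1 lam) (νX := gammaMeasure 2 mu) hc'.le ae_pos_gammaMeasure
    (half_le_self hR0.le) (by rw [hmuR]; positivity) ?_ ?_ ?_ y
  · rwa [lundbergFun, if_neg (not_lt.2 hy)] at h
  · intro z hz
    rw [mul_setLIntegral_Ioi_exp_gammaMeasure hmu hRmu z, gammaMeasure_two_Ioi (by linarith) hz,
      gammaMeasure_two_Ioi hmu hz, ← ENNReal.ofReal_mul (Real.exp_pos _).le]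
    refine ENNReal.ofReal_le_ofReal ?_
    rw [mul_left_comm, ← Real.exp_add, show -(R * z) + -((mu - R) * z) = -(mu * z) by ring]
    gcongr
    linarith
  · rw [lintegral_exp_mul_lintegral_exp_gammaMeasure one_pos two_pos hlam hmu hc' hR0 hRmu,
      Real.rpow_two, Real.rpow_one, ENNReal.one_le_ofReal, div_pow, div_mul_div_comm,
      one_le_div (by rw [hmuR]; positivity)]
    linear_combination R * hc'eq
  · have hs' : 0 < mu - R / 2 := by linarith
    rw [lintegral_exp_mul_lintegral_exp_gammaMeasure one_pos two_pos hlam hmu hc' (half_pos hR0)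
      (by linarith), Real.rpow_two, Real.rpow_one, ENNReal.ofReal_lt_one, div_pow,
      div_mul_div_comm, div_lt_one (by positivity)]
    -- with `s = mu - R`, the claim reduces to `(R/2 + s)² (R + 2 s) > s² (3 R / 2 + 2 s)`
    have h1 : 0 < c' * (mu - R / 2) ^ 2 - lam * (2 * mu - R / 2) := by
      refine pos_of_mul_pos_left (b := (mu - R) ^ 2) ?_ (sq_nonneg _)
      have h2 : (c' * (mu - R / 2) ^ 2 - lam * (2 * mu - R / 2)) * (mu - R) ^ 2
          = lam * ((2 * mu - R) * (mu - R / 2) ^ 2 - (2 * mu - R / 2) * (mu - R) ^ 2) := by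
        linear_combination (mu - R / 2) ^ 2 * hc'eq
      rw [h2]
      refine mul_pos hlam ?_
      have h3 : mu = R + s := by linarith
      rw [h3]
      have h4 : 0 < R ^ 3 / 4 + 3 / 2 * R ^ 2 * s + 3 / 2 * R * s ^ 2 := by positivity
      linear_combination h4
    have h5 := mul_pos (half_pos hR0) h1
    linear_combination h5

end GammaLundberg

/-! ### The linear premium: bounds and asymptotics -/

section Linear

variable {lam mu c ε : ℝ}

/-- With a linear premium and exponential interclaim times, the ruin probability decays at every
exponential rate `R` at which the claims have an exponential moment: far out, the premium rate is so
large that the Lundberg function with exponent `R` is a supersolution there, and the bound `1`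
suffices below. -/
lemma exists_ruinValue_linear_le (hlam : 0 < lam) (hmu : 0 < mu) (hc : 0 < c) (hε : 0 < ε) {R : ℝ}
    (hR : 0 < R) (hRmu : R < mu) : ∃ C : ℝ, 0 ≤ C ∧ ∀ y,
      ruinValue c ε (expMeasure lam) (erlangTwo mu) y
        ≤ ENNReal.ofReal (C * Real.exp (-(R * y))) := by
  have := isProbabilityMeasure_gammaMeasure two_pos hmu
  have := isProbabilityMeasure_gammaMeasure one_pos hlam
  have hs := sub_pos.2 hRmu
  rw [erlangTwo, expMeasure]
  set m : ℝ := (mu / (mu - R)) ^ (2 : ℝ) with hm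
  have hm0 : 0 < m := by positivity
  -- the threshold beyond which the premium rate exceeds `ε M`
  set M : ℝ := lam * m / (R * ε) with hM
  have hM0 : 0 < M := by positivity
  set V : ℝ → ℝ≥0∞ := fun y => if y ≤ M then 1 else ENNReal.ofReal (Real.exp (R * (M - y))) with hV
  have hVm : Measurable V := Measurable.ite measurableSet_Iic measurable_const (by fun_prop)
  have hV1 (y : ℝ) : V y ≤ 1 := by
    simp only [hV]
    split_ifs with h
    · exact le_rfl
    · rw [ENNReal.ofReal_le_one, Real.exp_le_one_iff]
      exact mul_nonpos_of_nonneg_of_nonpos hR.le (by linarith)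
  have hVe (y : ℝ) : V y ≤ ENNReal.ofReal (Real.exp (R * (M - y))) := by
    simp only [hV]
    split_ifs with h
    · rw [ENNReal.one_le_ofReal, Real.one_le_exp_iff]
      exact mul_nonneg hR.le (by linarith)
    · exact le_rfl
  refine ⟨Real.exp (R * M), (Real.exp_pos _).le, fun y =>
    (ruinValue_le_of_ruinOp_le (V := V) ?_ ?_ y).trans ((hVe y).trans (le_of_eq ?_))⟩
  · exact Set.indicator_le fun x hx => by simp [hV, (Set.mem_Iio.1 hx).le.trans hM0.le]
  · intro y
    rcases le_or_gt y M with hy | hy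
    · calc ruinOp c ε (gammaMeasure 1 lam) (gammaMeasure 2 mu) V y
          ≤ ∫⁻ z, 1 ∂((gammaMeasure 1 lam).prod (gammaMeasure 2 mu)) :=
            lintegral_mono fun z => hV1 _
        _ = V y := by simp [hV, hy]
    · have hy0 : 0 ≤ y := hM0.le.trans hy.le
      rw [ruinOp_of_nonneg hVm hy0]
      calc _ ≤ ∫⁻ t, ENNReal.ofReal (Real.exp (R * (M - y)))
            * (ENNReal.ofReal (Real.exp (-(R * (ε * M)) * t)) * ENNReal.ofReal m)
            ∂gammaMeasure 1 lam := by
            refine lintegral_mono_ae ?_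
            filter_upwards [ae_pos_gammaMeasure] with t ht
            rw [hm, ← lintegral_exp_gammaMeasure two_pos hmu hRmu,
              ← lintegral_const_mul _ (by fun_prop), ← lintegral_const_mul _ (by fun_prop)]
            refine lintegral_mono fun x => (hVe _).trans ?_
            rw [← ENNReal.ofReal_mul (Real.exp_pos _).le, ← Real.exp_add,
              ← ENNReal.ofReal_mul (Real.exp_pos _).le, ← Real.exp_add]
            refine ENNReal.ofReal_le_ofReal (Real.exp_le_exp.2 ?_)
            have h1 := le_premiumFlow hc.le hε.le hy0 ht.le
            have h2 : ε * M * t ≤ (c + ε * y) * t := by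
              have := mul_lt_mul_of_pos_left hy hε
              exact mul_le_mul_of_nonneg_right (by linarith) ht.le
            have h3 : R * (ε * M * t) ≤ R * (premiumFlow c ε y t - y) :=
              mul_le_mul_of_nonneg_left (by linarith) hR.le
            linarith
        _ = ENNReal.ofReal (Real.exp (R * (M - y)))
            * ENNReal.ofReal (lam / (lam + R * (ε * M)) * m) := by
            have h : 0 < R * (ε * M) := by positivity
            rw [lintegral_const_mul _ (by fun_prop), lintegral_mul_const _ (by fun_prop),
              lintegral_exp_gammaMeasure one_pos hlam (by linarith), sub_neg_eq_add, Real.rpow_one,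
              ← ENNReal.ofReal_mul (by positivity)]
        _ ≤ ENNReal.ofReal (Real.exp (R * (M - y))) * 1 := by
            gcongr
            rw [ENNReal.ofReal_le_one, div_mul_eq_mul_div, div_le_one (by positivity)]
            have : R * (ε * M) = lam * m := by rw [hM]; field_simp
            linarith
        _ = V y := by simp [hV, not_le.2 hy]
  · rw [← Real.exp_add]; ring_nf

/-- Averaging over an exponential claim, written as an integral over the surplus after the claim. -/
lemma lintegral_sub_expMeasure {f : ℝ → ℝ≥0∞} (hf : Measurable f) (z : ℝ) :
    ∫⁻ x, f (z - x) ∂expMeasure mu = ENNReal.ofReal (Real.exp (-(mu * z)))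
      * ∫⁻ w in Set.Iic z, ENNReal.ofReal (mu * Real.exp (mu * w)) * f w := by
  rw [expMeasure, lintegral_gammaMeasure (f := fun x => f (z - x)) (by fun_prop),
    ← lintegral_sub_left_eq_self _ z, ← lintegral_const_mul _ (by fun_prop),
    ← lintegral_indicator measurableSet_Iic]
  refine lintegral_congr fun w => ?_
  rcases le_or_gt w z with hw | hw
  · rw [Set.indicator_of_mem (Set.mem_Iic.2 hw), gammaPDF_of_nonneg (sub_nonneg.2 hw), ← mul_assoc,
      ← ENNReal.ofReal_mul (Real.exp_pos _).le, sub_sub_cancel]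
    congr 2
    have : Real.exp (-(mu * (z - w))) = Real.exp (-(mu * z)) * Real.exp (mu * w) := by
      rw [← Real.exp_add]; ring_nf
    rw [this]
    simp
    ring
  · rw [Set.indicator_of_notMem (by simpa using hw), gammaPDF_of_neg (sub_neg.2 hw), zero_mul]

lemma setLIntegral_Iic_exp (hmu : 0 < mu) (z : ℝ) :
    ∫⁻ w in Set.Iic z, ENNReal.ofReal (mu * Real.exp (mu * w))
      = ENNReal.ofReal (Real.exp (mu * z)) := by
  have := isProbabilityMeasure_expMeasure hmu
  have h := lintegral_sub_expMeasure (mu := mu) (f := fun _ => 1) measurable_const z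
  simp only [mul_one, lintegral_const, measure_univ] at h
  calc _ = ENNReal.ofReal (Real.exp (mu * z)) * (ENNReal.ofReal (Real.exp (-(mu * z)))
        * ∫⁻ w in Set.Iic z, ENNReal.ofReal (mu * Real.exp (mu * w))) := by
        rw [← mul_assoc, ← ENNReal.ofReal_mul (Real.exp_pos _).le, ← Real.exp_add, add_neg_cancel,
          Real.exp_zero, ENNReal.ofReal_one, one_mul]
    _ = _ := by rw [← h, mul_one]

lemma lintegral_exp_premiumFlow_le (hlam : 0 < lam) (hmu : 0 < mu) (hc : 0 < c) (hε : 0 < ε) {y : ℝ}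
    (hy : 0 ≤ y) :
    ∫⁻ t, ENNReal.ofReal (Real.exp (-(mu * premiumFlow c ε y t))) ∂erlangTwo lam
      ≤ ENNReal.ofReal (Real.exp (-(mu * y)) * (lam / (mu * (c + ε * y))) ^ 2) := by
  have hp : 0 < c + ε * y := by positivity
  have hmp : 0 < mu * (c + ε * y) := by positivity
  calc _ ≤ ∫⁻ t, ENNReal.ofReal (Real.exp (-(mu * y)))
        * ENNReal.ofReal (Real.exp (-(mu * (c + ε * y)) * t)) ∂erlangTwo lam := by
        refine lintegral_mono_ae ?_
        filter_upwards [ae_pos_gammaMeasure (a := 2) (r := lam)] with t ht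
        rw [← ENNReal.ofReal_mul (Real.exp_pos _).le, ← Real.exp_add]
        refine ENNReal.ofReal_le_ofReal (Real.exp_le_exp.2 ?_)
        have := mul_le_mul_of_nonneg_left (le_premiumFlow hc.le hε.le hy ht.le) hmu.le
        linarith
    _ = ENNReal.ofReal (Real.exp (-(mu * y)) * (lam / (lam + mu * (c + ε * y))) ^ 2) := by
        rw [lintegral_const_mul _ (by fun_prop), erlangTwo,
          lintegral_exp_gammaMeasure two_pos hlam (by linarith), sub_neg_eq_add, Real.rpow_two,
          ← ENNReal.ofReal_mul (Real.exp_pos _).le]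
    _ ≤ _ := by
        refine ENNReal.ofReal_le_ofReal ?_
        gcongr
        linarith

/-- The renewal equation for exponential claims. -/
lemma ruinValue_expMeasure_eq (hlam : 0 < lam) (hmu : 0 < mu) {y : ℝ} (hy : 0 ≤ y) :
    ruinValue c ε (erlangTwo lam) (expMeasure mu) y
      = ∫⁻ t, ENNReal.ofReal (Real.exp (-(mu * premiumFlow c ε y t)))
        * (∫⁻ w in Set.Iic (premiumFlow c ε y t), ENNReal.ofReal (mu * Real.exp (mu * w))
          * ruinValue c ε (erlangTwo lam) (expMeasure mu) w) ∂erlangTwo lam := by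
  have : IsProbabilityMeasure (erlangTwo lam) := isProbabilityMeasure_gammaMeasure two_pos hlam
  have := isProbabilityMeasure_expMeasure hmu
  rw [← ruinOp_ruinValue, ruinOp_of_nonneg measurable_ruinValue hy]
  refine lintegral_congr fun t => ?_
  rw [lintegral_sub_expMeasure measurable_ruinValue]

/-- The ruin probability `ψ` for a linear premium and Exp(`mu`) claims is so small that
`e^{mu w} ψ(w)` is integrable. The supersolution behind this is `1` up to a threshold `M` and
`A e^{-mu y} (c + ε y)^{-2}` beyond it. -/
lemma lintegral_exp_mul_ruinValue_ne_top (hlam : 0 < lam) (hmu : 0 < mu) (hc : 0 < c)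
    (hε : 0 < ε) :
    ∫⁻ w, ENNReal.ofReal (mu * Real.exp (mu * w))
      * ruinValue c ε (erlangTwo lam) (expMeasure mu) w ≠ ∞ := by
  have : IsProbabilityMeasure (erlangTwo lam) := isProbabilityMeasure_gammaMeasure two_pos hlam
  have := isProbabilityMeasure_expMeasure hmu
  -- `p` is the premium rate at the threshold `M`, and `A` makes the two branches agree there
  set p : ℝ := c + 1 + (lam / mu) ^ 2 * (1 + mu / ε) with hp
  have hp1 : 1 ≤ p := by
    have : 0 < (lam / mu) ^ 2 * (1 + mu / ε) := by positivity
    linarith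
  have hp0 : 0 < p := by linarith
  set M : ℝ := (p - c) / ε with hM
  have hpM : c + ε * M = p := by rw [hM]; field_simp; ring
  have hM0 : 0 < M := by
    have : 0 < (lam / mu) ^ 2 * (1 + mu / ε) := by positivity
    exact div_pos (by linarith) hε
  set A : ℝ := Real.exp (mu * M) * p ^ 2 with hA
  have hA0 : 0 < A := by positivity
  set V : ℝ → ℝ≥0∞ := fun y =>
    if y ≤ M then 1 else ENNReal.ofReal (A * (Real.exp (-(mu * y)) * ((c + ε * y) ^ 2)⁻¹)) with hV
  have hVm : Measurable V := Measurable.ite measurableSet_Iic measurable_const (by fun_prop)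
  have hV1 (y : ℝ) : V y ≤ 1 := by
    simp only [hV]
    split_ifs with h
    · exact le_rfl
    · have hyM := not_le.1 h
      have hpy : p ≤ c + ε * y := by rw [← hpM]; gcongr
      rw [ENNReal.ofReal_le_one]
      calc A * (Real.exp (-(mu * y)) * ((c + ε * y) ^ 2)⁻¹)
          ≤ A * (Real.exp (-(mu * M)) * (p ^ 2)⁻¹) := by gcongr
        _ = 1 := by
          rw [hA, Real.exp_neg]
          have := (Real.exp_pos (mu * M)).ne'
          field_simp
  have hmass : ∫⁻ w, ENNReal.ofReal (mu * Real.exp (mu * w)) * V w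
      = ENNReal.ofReal (Real.exp (mu * M) + mu * A / (ε * p)) := by
    rw [← lintegral_add_compl _ (measurableSet_Iic (a := M)), Set.compl_Iic,
      ENNReal.ofReal_add (Real.exp_pos _).le (by positivity), ← setLIntegral_Iic_exp hmu]
    congr 1
    · refine setLIntegral_congr_fun measurableSet_Iic fun w hw => ?_
      simp [hV, Set.mem_Iic.1 hw]
    · have h := setLIntegral_Ioi_deriv (y := M) (g := fun w => -(mu * A / ε * (c + ε * w)⁻¹))
        (g' := fun w => mu * A * ((c + ε * w) ^ 2)⁻¹) (fun w hw => by
          have hw0 : c + ε * w ≠ 0 := by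
            have : 0 ≤ ε * w := mul_nonneg hε.le (hM0.le.trans hw)
            linarith
          refine (((((hasDerivAt_id w).const_mul ε).const_add c).inv hw0).const_mul
            (mu * A / ε)).neg.congr_deriv ?_
          simp only [id]
          field_simp) (fun w _ => by positivity) (by
          have h1 : Tendsto (fun w : ℝ => c + ε * w) atTop atTop :=
            tendsto_atTop_add_const_left _ _ (tendsto_id.const_mul_atTop hε)
          simpa using ((tendsto_inv_atTop_zero.comp h1).const_mul (mu * A / ε)).neg)
      rw [neg_neg, hpM] at h
      rw [show mu * A / (ε * p) = mu * A / ε * p⁻¹ by field_simp, ← h]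
      refine setLIntegral_congr_fun measurableSet_Ioi fun w hw => ?_
      simp only [hV, if_neg (not_le.2 (Set.mem_Ioi.1 hw))]
      rw [← ENNReal.ofReal_mul (by positivity)]
      congr 1
      rw [Real.exp_neg]
      have := (Real.exp_pos (mu * w)).ne'
      field_simp
  have hsuper : ruinOp c ε (erlangTwo lam) (expMeasure mu) V ≤ V := by
    intro y
    rcases le_or_gt y M with hy | hy
    · calc ruinOp c ε (erlangTwo lam) (expMeasure mu) V y
          ≤ ∫⁻ z, 1 ∂((erlangTwo lam).prod (expMeasure mu)) := lintegral_mono fun z => hV1 _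
        _ = V y := by simp [hV, hy]
    · have hy0 : 0 ≤ y := hM0.le.trans hy.le
      have hpy : 0 < c + ε * y := by positivity
      rw [ruinOp_of_nonneg hVm hy0]
      calc _ ≤ ∫⁻ t, ENNReal.ofReal (Real.exp (-(mu * premiumFlow c ε y t)))
            * ENNReal.ofReal (Real.exp (mu * M) + mu * A / (ε * p)) ∂erlangTwo lam := by
            refine lintegral_mono fun t => ?_
            rw [lintegral_sub_expMeasure hVm, ← hmass]
            gcongr
            exact Measure.restrict_le_self
        _ ≤ ENNReal.ofReal (Real.exp (-(mu * y)) * (lam / (mu * (c + ε * y))) ^ 2)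
            * ENNReal.ofReal (Real.exp (mu * M) + mu * A / (ε * p)) := by
            rw [lintegral_mul_const' _ _ ENNReal.ofReal_ne_top]
            gcongr
            exact lintegral_exp_premiumFlow_le hlam hmu hc hε hy0
        _ ≤ V y := by
            simp only [hV, if_neg (not_le.2 hy)]
            rw [← ENNReal.ofReal_mul (by positivity)]
            refine ENNReal.ofReal_le_ofReal ?_
            have h1 : (lam / mu) ^ 2 * (1 + mu / ε) ≤ p := by linarith
            have h2 : (lam / mu) ^ 2 * (1 + mu * p / ε) ≤ p ^ 2 := by
              calc (lam / mu) ^ 2 * (1 + mu * p / ε)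
                  ≤ (lam / mu) ^ 2 * (p + mu * p / ε) := by gcongr
                _ = (lam / mu) ^ 2 * (1 + mu / ε) * p := by ring
                _ ≤ p * p := by gcongr
                _ = p ^ 2 := by ring
            calc Real.exp (-(mu * y)) * (lam / (mu * (c + ε * y))) ^ 2
                  * (Real.exp (mu * M) + mu * A / (ε * p))
                = Real.exp (mu * M) * ((lam / mu) ^ 2 * (1 + mu * p / ε))
                  * (Real.exp (-(mu * y)) * ((c + ε * y) ^ 2)⁻¹) := by
                  rw [hA]; field_simp
              _ ≤ Real.exp (mu * M) * p ^ 2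
                  * (Real.exp (-(mu * y)) * ((c + ε * y) ^ 2)⁻¹) := by gcongr
  have hle : ruinValue c ε (erlangTwo lam) (expMeasure mu) ≤ V :=
    ruinValue_le_of_ruinOp_le (Set.indicator_le fun x hx => by
      simp [hV, (Set.mem_Iio.1 hx).le.trans hM0.le]) hsuper
  refine ne_top_of_le_ne_top (b := ENNReal.ofReal (Real.exp (mu * M) + mu * A / (ε * p)))
    ENNReal.ofReal_ne_top ?_
  rw [← hmass]
  exact lintegral_mono fun w => mul_le_mul_right (hle w) _

end Linear

section Asymptotics

variable {lam mu c ε : ℝ}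

lemma lintegral_eq_mul_lintegral_scale {p : ℝ} (hp : 0 < p) {f : ℝ → ℝ≥0∞} (hf : Measurable f) :
    ∫⁻ t, f t = ENNReal.ofReal p⁻¹ * ∫⁻ s, f (p⁻¹ * s) := by
  conv_lhs => rw [← Real.smul_map_volume_mul_left (inv_ne_zero hp.ne')]
  rw [lintegral_smul_measure, lintegral_map hf (by fun_prop), abs_of_pos (inv_pos.2 hp),
    smul_eq_mul]

lemma tendsto_mul_integral_exp (ε s : ℝ) :
    Tendsto (fun p : ℝ => p * ∫ r in (0 : ℝ)..(p⁻¹ * s), Real.exp (ε * r)) atTop (𝓝 s) := by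
  have h : HasDerivAt (fun q : ℝ => ∫ r in (0 : ℝ)..(q * s), Real.exp (ε * r)) s 0 := by
    have h1 := (hasDerivAt_integral_exp ε (0 * s)).comp (0 : ℝ)
      ((hasDerivAt_id (0 : ℝ)).mul_const s)
    simpa [Function.comp_def] using h1
  have h2 : Tendsto (fun p : ℝ => p⁻¹) atTop (𝓝[≠] 0) :=
    tendsto_nhdsWithin_iff.2 ⟨tendsto_inv_atTop_zero,
      (eventually_gt_atTop 0).mono fun p hp => (inv_pos.2 hp).ne'⟩
  simpa [Function.comp_def] using (hasDerivAt_iff_tendsto_slope_zero.1 h).comp h2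

/-- Laplace asymptotics of the premium flow: only interclaim times of order `1 / (c + ε u)`
contribute, over which the premium rate is nearly constant. The rescaling `t = s / (c + ε u)` makes
this an instance of dominated convergence. -/
lemma tendsto_lintegral_exp_premiumFlow (hlam : 0 < lam) (hmu : 0 < mu) (hc : 0 < c)
    (hε : 0 < ε) :
    Tendsto (fun u => ENNReal.ofReal (Real.exp (mu * u) * (c + ε * u) ^ 2)
      * ∫⁻ t, ENNReal.ofReal (Real.exp (-(mu * premiumFlow c ε u t))) ∂erlangTwo lam) atTop
      (𝓝 (ENNReal.ofReal ((lam / mu) ^ 2))) := by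
  set F : ℝ → ℝ → ℝ≥0∞ := fun u s => ENNReal.ofReal (Real.exp (mu * u) * (c + ε * u) ^ 2)
    * (ENNReal.ofReal (c + ε * u)⁻¹ * (gammaPDF 2 lam ((c + ε * u)⁻¹ * s)
      * ENNReal.ofReal (Real.exp (-(mu * premiumFlow c ε u ((c + ε * u)⁻¹ * s)))))) with hF
  have hflow (u : ℝ) : Measurable fun t => premiumFlow c ε u t :=
    (continuous_premiumFlow c ε).measurable.comp (measurable_const.prodMk measurable_id)
  have hpdf := measurable_gammaPDF 2 lam
  have hint (u : ℝ) : Measurable fun t =>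
      gammaPDF 2 lam t * ENNReal.ofReal (Real.exp (-(mu * premiumFlow c ε u t))) := by
    have := hflow u
    fun_prop
  have hFm (u : ℝ) : Measurable (F u) := by
    have := (hint u).comp (measurable_const_mul (c + ε * u)⁻¹)
    exact (this.const_mul _).const_mul _
  have hFneg (u : ℝ) (hu : 0 ≤ u) {s : ℝ} (hs : s < 0) : F u s = 0 := by
    have hp : 0 < c + ε * u := by positivity
    simp only [hF]
    rw [gammaPDF_of_neg (mul_neg_of_pos_of_neg (inv_pos.2 hp) hs)]
    simp
  have hFpos (u : ℝ) (hu : 0 ≤ u) {s : ℝ} (hs : 0 ≤ s) : F u s = ENNReal.ofReal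
      (lam ^ 2 * s * Real.exp (-(lam * ((c + ε * u)⁻¹ * s))) * Real.exp
        (-(mu * ((c + ε * u) * ∫ r in (0 : ℝ)..((c + ε * u)⁻¹ * s), Real.exp (ε * r))))) := by
    have hp : 0 < c + ε * u := by positivity
    simp only [hF]
    rw [gammaPDF_two_of_nonneg (by positivity), ← ENNReal.ofReal_mul (by positivity),
      ← ENNReal.ofReal_mul (by positivity), ← ENNReal.ofReal_mul (by positivity)]
    congr 1
    have h1 : Real.exp (-(mu * premiumFlow c ε u ((c + ε * u)⁻¹ * s)))
        = (Real.exp (mu * u))⁻¹ * Real.exp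
          (-(mu * ((c + ε * u) * ∫ r in (0 : ℝ)..((c + ε * u)⁻¹ * s), Real.exp (ε * r)))) := by
      rw [← Real.exp_neg, ← Real.exp_add, premiumFlow]
      ring_nf
    rw [h1]
    have := (Real.exp_pos (mu * u)).ne'
    field_simp
  have hlimpos {s : ℝ} (hs : 0 ≤ s) : ENNReal.ofReal ((lam / mu) ^ 2) * gammaPDF 2 mu s
      = ENNReal.ofReal (lam ^ 2 * s * Real.exp (-(mu * s))) := by
    rw [gammaPDF_two_of_nonneg hs, ← ENNReal.ofReal_mul (by positivity)]
    congr 1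
    field_simp
  have hmass : ∫⁻ s, ENNReal.ofReal ((lam / mu) ^ 2) * gammaPDF 2 mu s
      = ENNReal.ofReal ((lam / mu) ^ 2) := by
    rw [lintegral_const_mul _ (measurable_gammaPDF 2 mu), lintegral_gammaPDF_eq_one two_pos hmu,
      mul_one]
  have hrate : Tendsto (fun u : ℝ => c + ε * u) atTop atTop :=
    tendsto_atTop_add_const_left _ _ (tendsto_id.const_mul_atTop hε)
  have hdct := tendsto_lintegral_filter_of_dominated_convergence (μ := volume) (l := atTop) (F := F)
    (f := fun s => ENNReal.ofReal ((lam / mu) ^ 2) * gammaPDF 2 mu s)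
    (fun s => ENNReal.ofReal ((lam / mu) ^ 2) * gammaPDF 2 mu s) (Eventually.of_forall hFm) ?_
    (by rw [hmass]; exact ENNReal.ofReal_ne_top) ?_
  · rw [hmass] at hdct
    refine hdct.congr' ?_
    filter_upwards [eventually_ge_atTop 0] with u hu
    have hp : 0 < c + ε * u := by positivity
    rw [erlangTwo, lintegral_gammaMeasure (by have := hflow u; fun_prop),
      lintegral_eq_mul_lintegral_scale hp (hint u)]
    have := (hint u).comp (measurable_const_mul (c + ε * u)⁻¹)
    simp only [Function.comp_def] at this
    rw [← lintegral_const_mul _ this, ← lintegral_const_mul _ (this.const_mul _)]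
  · filter_upwards [eventually_ge_atTop 0] with u hu
    refine Eventually.of_forall fun s => ?_
    rcases lt_or_ge s 0 with hs | hs
    · rw [hFneg u hu hs]; exact zero_le
    · have hp : 0 < c + ε * u := by positivity
      rw [hFpos u hu hs, hlimpos hs]
      refine ENNReal.ofReal_le_ofReal ?_
      have h1 : s ≤ (c + ε * u) * ∫ r in (0 : ℝ)..((c + ε * u)⁻¹ * s), Real.exp (ε * r) := by
        have := mul_le_mul_of_nonneg_left
          (le_integral_exp hε.le (by positivity : 0 ≤ (c + ε * u)⁻¹ * s)) hp.le
        rwa [mul_inv_cancel_left₀ hp.ne'] at this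
      have h2 : Real.exp (-(lam * ((c + ε * u)⁻¹ * s))) ≤ 1 :=
        Real.exp_le_one_iff.2 (neg_nonpos.2 (by positivity))
      calc _ ≤ lam ^ 2 * s * 1 * Real.exp (-(mu * s)) := by gcongr
        _ = _ := by rw [mul_one]
  · refine Eventually.of_forall fun s => ?_
    rcases lt_or_ge s 0 with hs | hs
    · rw [gammaPDF_of_neg hs, mul_zero]
      refine tendsto_const_nhds.congr' ?_
      filter_upwards [eventually_ge_atTop 0] with u hu
      rw [hFneg u hu hs]
    · rw [hlimpos hs]
      have h1 : Tendsto (fun u : ℝ => Real.exp (-(lam * ((c + ε * u)⁻¹ * s)))) atTop (𝓝 1) := by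
        have := (((tendsto_inv_atTop_zero.comp hrate).mul_const s).const_mul lam).neg.rexp
        simpa [Function.comp_def] using this
      have h2 := (((tendsto_mul_integral_exp ε s).comp hrate).const_mul mu).neg.rexp
      have h3 := ENNReal.tendsto_ofReal ((h1.const_mul (lam ^ 2 * s)).mul h2)
      rw [mul_one] at h3
      refine h3.congr' ?_
      filter_upwards [eventually_ge_atTop 0] with u hu
      rw [hFpos u hu hs]
      rfl

/-- The ruin probability for a linear premium, Erlang(2) interclaim times and exponential claims
satisfies `ψ(u) ~ (lam / mu)² H e^{-mu u} (c + ε u)^{-2}` with `H = ∫ mu e^{mu w} ψ(w) dw`. The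
inner integral of the renewal equation lies between its values at the upper limits `u` and `∞`,
which have the common limit `H`. -/
lemma tendsto_ruinValue_linear (hlam : 0 < lam) (hmu : 0 < mu) (hc : 0 < c) (hε : 0 < ε) :
    Tendsto (fun u => ENNReal.ofReal (Real.exp (mu * u) * (c + ε * u) ^ 2)
      * ruinValue c ε (erlangTwo lam) (expMeasure mu) u) atTop
      (𝓝 (ENNReal.ofReal ((lam / mu) ^ 2) * ∫⁻ w, ENNReal.ofReal (mu * Real.exp (mu * w))
        * ruinValue c ε (erlangTwo lam) (expMeasure mu) w)) := by
  have : IsProbabilityMeasure (erlangTwo lam) := isProbabilityMeasure_gammaMeasure two_pos hlam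
  have := isProbabilityMeasure_expMeasure hmu
  have hfin := lintegral_exp_mul_ruinValue_ne_top hlam hmu hc hε
  have hm : Measurable fun w => ENNReal.ofReal (mu * Real.exp (mu * w))
      * ruinValue c ε (erlangTwo lam) (expMeasure mu) w :=
    Measurable.mul (by fun_prop) measurable_ruinValue
  set f : ℝ → ℝ≥0∞ := fun w => ENNReal.ofReal (mu * Real.exp (mu * w))
    * ruinValue c ε (erlangTwo lam) (expMeasure mu) w
  have hflow (u : ℝ) : Measurable fun t => premiumFlow c ε u t :=
    (continuous_premiumFlow c ε).measurable.comp (measurable_const.prodMk measurable_id)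
  have hexp (u : ℝ) : Measurable fun t =>
      ENNReal.ofReal (Real.exp (-(mu * premiumFlow c ε u t))) := by
    have := hflow u
    fun_prop
  have hh : Tendsto (fun u => ∫⁻ w in Set.Iic u, f w) atTop (𝓝 (∫⁻ w, f w)) := by
    have := tendsto_lintegral_filter_of_dominated_convergence (μ := volume) (l := atTop (α := ℝ))
      (F := fun u => (Set.Iic u).indicator f) (f := f) f
      (Eventually.of_forall fun u => hm.indicator measurableSet_Iic)
      (Eventually.of_forall fun u => Eventually.of_forall fun w => Set.indicator_le_self _ _ _)
      hfin (Eventually.of_forall fun w => tendsto_const_nhds.congr' <| by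
        filter_upwards [eventually_ge_atTop w] with u hu
        rw [Set.indicator_of_mem (Set.mem_Iic.2 hu)])
    simpa only [lintegral_indicator measurableSet_Iic] using this
  have hI := tendsto_lintegral_exp_premiumFlow hlam hmu hc hε
  have htop : ENNReal.ofReal ((lam / mu) ^ 2) ≠ ∞ := ENNReal.ofReal_ne_top
  refine tendsto_of_tendsto_of_tendsto_of_le_of_le'
    (ENNReal.Tendsto.mul hI (Or.inr hfin) hh (Or.inr htop))
    (ENNReal.Tendsto.mul_const hI (Or.inr hfin)) ?_ ?_
  · filter_upwards [eventually_ge_atTop 0] with u hu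
    rw [ruinValue_expMeasure_eq hlam hmu hu, mul_assoc, ← lintegral_mul_const _ (hexp u)]
    refine mul_le_mul_right (lintegral_mono_ae ?_) _
    filter_upwards [ae_pos_gammaMeasure (a := 2) (r := lam)] with t ht
    have h1 := le_premiumFlow hc.le hε.le hu ht.le
    have h2 : 0 ≤ (c + ε * u) * t := by positivity
    gcongr
    linarith
  · filter_upwards [eventually_ge_atTop 0] with u hu
    rw [ruinValue_expMeasure_eq hlam hmu hu, mul_assoc, ← lintegral_mul_const _ (hexp u)]
    gcongr
    exact Measure.restrict_le_self

lemma exists_ruinValue_linear_expMeasure_le (hlam : 0 < lam) (hmu : 0 < mu) (hc : 0 < c)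
    (hε : 0 < ε) : ∃ C : ℝ, 0 ≤ C ∧ ∀ y, 0 ≤ y →
      ruinValue c ε (erlangTwo lam) (expMeasure mu) y
        ≤ ENNReal.ofReal (C * Real.exp (-(mu * y))) := by
  have hfin := lintegral_exp_mul_ruinValue_ne_top hlam hmu hc hε
  set H := ∫⁻ w, ENNReal.ofReal (mu * Real.exp (mu * w))
    * ruinValue c ε (erlangTwo lam) (expMeasure mu) w
  refine ⟨(lam / (mu * c)) ^ 2 * H.toReal, by positivity, fun y hy => ?_⟩
  calc _ ≤ ∫⁻ t, ENNReal.ofReal (Real.exp (-(mu * premiumFlow c ε y t))) * H ∂erlangTwo lam := by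
        rw [ruinValue_expMeasure_eq hlam hmu hy]
        refine lintegral_mono fun t => mul_le_mul_right ?_ _
        exact lintegral_mono' Measure.restrict_le_self le_rfl
    _ ≤ ENNReal.ofReal (Real.exp (-(mu * y)) * (lam / (mu * (c + ε * y))) ^ 2)
        * ENNReal.ofReal H.toReal := by
        rw [lintegral_mul_const' _ _ hfin, ENNReal.ofReal_toReal hfin]
        gcongr
        exact lintegral_exp_premiumFlow_le hlam hmu hc hε hy
    _ ≤ _ := by
        rw [← ENNReal.ofReal_mul (by positivity), mul_comm _ (Real.exp _), ← mul_assoc]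
        refine ENNReal.ofReal_le_ofReal ?_
        have : 0 ≤ ε * y := by positivity
        gcongr
        linarith

end Asymptotics

/-! ### Comparison of the two ruin probabilities -/

lemma tendsto_div_zero_of_exp_bounds {f g : ℝ → ℝ} {C k R S : ℝ} (hk : 0 < k) (hSR : S < R)
    (hf0 : ∀ u, 0 ≤ u → 0 ≤ f u) (hf : ∀ u, 0 ≤ u → f u ≤ C * Real.exp (-(R * u)))
    (hg : ∀ u, 0 ≤ u → k * Real.exp (-(S * u)) ≤ g u) :
    Tendsto (fun u => f u / g u) atTop (𝓝 0) := by
  have hlim : Tendsto (fun u : ℝ => C / k * Real.exp (-((R - S) * u))) atTop (𝓝 0) := by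
    have h := Real.tendsto_exp_neg_atTop_nhds_zero.comp
      (tendsto_id.const_mul_atTop (sub_pos.2 hSR))
    simpa [Function.comp_def] using h.const_mul (C / k)
  refine squeeze_zero' ?_ ?_ hlim
  · filter_upwards [eventually_ge_atTop 0] with u hu
    exact div_nonneg (hf0 u hu) (le_trans (by positivity) (hg u hu))
  · filter_upwards [eventually_ge_atTop 0] with u hu
    have h1 : Real.exp (-((R - S) * u)) = Real.exp (-(R * u)) / Real.exp (-(S * u)) := by
      rw [← Real.exp_sub]; ring_nf
    rw [h1, div_mul_div_comm]
    exact div_le_div₀ ((hf0 u hu).trans (hf u hu)) (hf u hu) (by positivity) (hg u hu)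

lemma constPremium_eq (c : ℝ) : constPremium c = linearPremium c 0 := by
  funext x; simp [constPremium, linearPremium]

theorem mainTheorem4 (lam mu c ε : ℝ) (hlam : 0 < lam) (hmu : 0 < mu) (hc : 0 < c) (hε : 0 < ε) :
    -- Erlang(2, lam) interclaim times, Exp(mu) claims: the ratio tends to zero,
    (∀ (L : RiskModel (erlangTwo lam) (expMeasure mu) (linearPremium c ε))
        (K : RiskModel (erlangTwo lam) (expMeasure mu) (constPremium c)),
        Tendsto (fun u => L.ruinProb u / K.ruinProb u) atTop (𝓝 0)) ∧
    -- and, under the net profit condition, its precise exponential decay;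
    (1 / mu < 2 * c / lam → ∃ C : ℝ, 0 < C ∧
      ∀ (L : RiskModel (erlangTwo lam) (expMeasure mu) (linearPremium c ε))
        (K : RiskModel (erlangTwo lam) (expMeasure mu) (constPremium c)),
        (fun u => L.ruinProb u / K.ruinProb u) ~[atTop] fun u =>
          C * Real.exp
              (-((c * mu + 2 * lam - Real.sqrt (c ^ 2 * mu ^ 2 + 4 * c * lam * mu)) / (2 * c)) * u)
            * (c + ε * u) ^ (-2 : ℤ)) ∧
    -- Exp(lam) interclaim times, Erlang(2, mu) claims: the ratio tends to zero.
    (∀ (L : RiskModel (expMeasure lam) (erlangTwo mu) (linearPremium c ε))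
        (K : RiskModel (expMeasure lam) (erlangTwo mu) (constPremium c)),
        Tendsto (fun u => L.ruinProb u / K.ruinProb u) atTop (𝓝 0)) := by
  have : IsProbabilityMeasure (erlangTwo lam) := isProbabilityMeasure_gammaMeasure two_pos hlam
  have : IsProbabilityMeasure (expMeasure mu) := isProbabilityMeasure_expMeasure hmu
  have hT2 : ∀ᵐ t ∂erlangTwo lam, 0 < t := ae_pos_gammaMeasure
  have hT1 : ∀ᵐ t ∂expMeasure lam, 0 < t := ae_pos_gammaMeasure
  refine ⟨fun L K => ?_, fun hnet => ?_, fun L K => ?_⟩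
  · -- the net profit condition holds for the larger premium `c'`
    set c' : ℝ := max c (lam / mu)
    have hc' : 0 < c' := hc.trans_le (le_max_left _ _)
    have hnet : lam < 2 * c' * mu := by
      have h1 : lam ≤ c' * mu := (div_le_iff₀ hmu).1 (le_max_right c (lam / mu))
      linarith [mul_pos hc' hmu]
    have hRmu := adjustCoeff_lt hlam hmu hc'
    obtain ⟨C, hC, hle⟩ := exists_ruinValue_linear_expMeasure_le hlam hmu hc hε
    refine tendsto_div_zero_of_exp_bounds (C := C) (k := (mu - adjustCoeff lam mu c') / mu)
      (div_pos (sub_pos.2 hRmu) hmu) hRmu (fun u _ => L.ruinProb_nonneg u) (fun u hu => ?_)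
      fun u hu => ?_
    · have := hle u hu
      rwa [← L.ofReal_ruinProb rfl hc.le hε.le hT2 hu,
        ENNReal.ofReal_le_ofReal_iff (by positivity)] at this
    · have := ruinValue_anti_premium (νX := expMeasure mu) (hT2.mono fun _ h => le_of_lt h)
        (le_max_left c (lam / mu)) le_rfl u
      rwa [ruinValue_const_expMeasure hlam hmu hc' hnet hu,
        ← K.ofReal_ruinProb (constPremium_eq c) hc.le le_rfl hT2 hu,
        ENNReal.ofReal_le_ofReal_iff (K.ruinProb_nonneg u)] at this
  · have hnet' : lam < 2 * c * mu := by
      rw [div_lt_div_iff₀ hmu hlam] at hnet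
      linarith
    have hRmu := adjustCoeff_lt hlam hmu hc
    have hfin := lintegral_exp_mul_ruinValue_ne_top hlam hmu hc hε
    have hlim := tendsto_ruinValue_linear hlam hmu hc hε
    set H := ∫⁻ w, ENNReal.ofReal (mu * Real.exp (mu * w))
      * ruinValue c ε (erlangTwo lam) (expMeasure mu) w
    -- ruin is certain from a negative surplus, which already contributes mass `1` to `H`
    have hH1 : 1 ≤ H := by
      calc (1 : ℝ≥0∞) = ∫⁻ w in Set.Iic 0, ENNReal.ofReal (mu * Real.exp (mu * w)) := by
            rw [setLIntegral_Iic_exp hmu]; simp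
        _ = ∫⁻ w in Set.Iio 0, ENNReal.ofReal (mu * Real.exp (mu * w)) :=
            setLIntegral_congr Iio_ae_eq_Iic.symm
        _ = ∫⁻ w in Set.Iio 0, ENNReal.ofReal (mu * Real.exp (mu * w))
            * ruinValue c ε (erlangTwo lam) (expMeasure mu) w :=
            setLIntegral_congr_fun measurableSet_Iio fun w hw => by
              simp only [ruinValue_of_neg (Set.mem_Iio.1 hw), mul_one]
        _ ≤ H := setLIntegral_le_lintegral _ _
    have hH0 : 0 < H.toReal := ENNReal.toReal_pos (zero_lt_one.trans_le hH1).ne' hfin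
    have hs := sub_pos.2 hRmu
    refine ⟨(lam / mu) ^ 2 * H.toReal * (mu / (mu - adjustCoeff lam mu c)), by positivity,
      fun L K => isEquivalent_of_tendsto_one ?_⟩
    have hexp : (c * mu + 2 * lam - Real.sqrt (c ^ 2 * mu ^ 2 + 4 * c * lam * mu)) / (2 * c)
        = mu - adjustCoeff lam mu c := by
      rw [adjustCoeff]; field_simp; ring
    rw [hexp]
    set R := adjustCoeff lam mu c
    have hlimR : Tendsto (fun u => Real.exp (mu * u) * (c + ε * u) ^ 2 * L.ruinProb u) atTop
        (𝓝 ((lam / mu) ^ 2 * H.toReal)) := by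
      have h := (ENNReal.tendsto_toReal (ENNReal.mul_ne_top ENNReal.ofReal_ne_top hfin)).comp hlim
      rw [ENNReal.toReal_mul, ENNReal.toReal_ofReal (by positivity)] at h
      refine h.congr' ?_
      filter_upwards [eventually_ge_atTop 0] with u hu
      rw [Function.comp_apply, ← L.ofReal_ruinProb rfl hc.le hε.le hT2 hu, ENNReal.toReal_mul,
        ENNReal.toReal_ofReal (by positivity), ENNReal.toReal_ofReal (L.ruinProb_nonneg u)]
    have hone := hlimR.div_const ((lam / mu) ^ 2 * H.toReal)
    rw [div_self (by positivity)] at hone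
    refine hone.congr' ?_
    filter_upwards [eventually_ge_atTop 0] with u hu
    have hK : K.ruinProb u = (mu - R) / mu * Real.exp (-(R * u)) := by
      have h := K.ofReal_ruinProb (constPremium_eq c) hc.le le_rfl hT2 hu
      rw [ruinValue_const_expMeasure hlam hmu hc hnet' hu] at h
      exact (ENNReal.ofReal_eq_ofReal_iff (K.ruinProb_nonneg u) (by positivity)).1 h
    have hp : 0 < c + ε * u := by positivity
    have h1 : Real.exp (-(mu - R) * u) = Real.exp (-(mu * u)) / Real.exp (-(R * u)) := by
      rw [← Real.exp_sub]; ring_nf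
    have h2 := (Real.exp_pos (-(R * u))).ne'
    have h3 := (Real.exp_pos (mu * u)).ne'
    rw [Pi.div_apply, hK, h1, Real.exp_neg (mu * u), zpow_neg]
    simp only [zpow_ofNat]
    field_simp
  · obtain ⟨S, k, hS0, hSmu, hk, hKle⟩ := exists_le_ruinValue_const_erlangTwo hlam hmu hc
    obtain ⟨R, hSR, hRmu⟩ := exists_between hSmu
    obtain ⟨C, hC, hLle⟩ := exists_ruinValue_linear_le hlam hmu hc hε (hS0.trans hSR) hRmu
    refine tendsto_div_zero_of_exp_bounds (C := C) (k := k) hk hSR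
      (fun u _ => L.ruinProb_nonneg u) (fun u hu => ?_) fun u hu => ?_
    · have := hLle u
      rwa [← L.ofReal_ruinProb rfl hc.le hε.le hT1 hu,
        ENNReal.ofReal_le_ofReal_iff (by positivity)] at this
    · have := hKle u hu
      rwa [← K.ofReal_ruinProb (constPremium_eq c) hc.le le_rfl hT1 hu,
        ENNReal.ofReal_le_ofReal_iff (K.ruinProb_nonneg u)] at this
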